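/- Let $\mathcal A$ be a finite or countable alphabet, let $\Omega=\mathcal A^{\mathbb Z}$ carry the $\sigma$-algebra generated by the cylinder sets, let $(T\omega)_i=\omega_{i+1}$ be the left shift on $\Omega$, and let $P$ be a $T$-invariant probability measure on $\Omega$. A cylinder set on an interval of integers $[l,r]$, $l\le r$, is a set $\{\omega:\omega_i=a_i,\ l\le i\le r\}$ with $a_l,\dots,a_r\in\mathcal A$. For $m\in\mathbb Z$ let $\mathcal F_{-\infty,m}$ and $\mathcal F_{m,\infty}$ be the $\sigma$-algebras generated by the cylinder sets on intervals contained in $(-\infty,m]$ and in $[m,\infty)$, respectively. For $k\ge 1$ put $$\phi(k)=\sup_{m\in\mathbb Z}\ \sup\Big\{\Big|\frac{P(\Gamma\cap\Delta)}{P(\Gamma)}-P(\Delta)\Big|:\ \Gamma\in\mathcal F_{-\infty,m},\ \Delta\in\mathcal F_{m+k,\infty},\ P(\Gamma)\ne 0\Big\},$$ $$\psi(k)=\sup_{m\in\mathbb Z}\ \sup\Big\{\Big|\frac{P(\Gamma\cap\Delta)}{P(\Gamma)P(\Delta)}-1\Big|:\ \Gamma\in\mathcal F_{-\infty,m},\ \Delta\in\mathcal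 F_{m+k,\infty},\ P(\Gamma)P(\Delta)\ne 0\Big\}\in[0,\infty].$$ Let $\ell\ge 1$ and let $q_1,\dots,q_\ell$ be functions from the nonnegative integers to the nonnegative integers for which there is a constant $K>0$ such that (a) for all $1\le i,j\le\ell$ with $i\ne j$ and every integer $k$, the number of integers $n\ge 0$ satisfying at least one of the equations $q_i(n)-q_j(n)=k$ and $q_i(n)=k$ does not exceed $K$ (if $\ell=1$: for every integer $k$, the number of integers $n\ge0$ with $q_1(n)=k$ does not exceed $K$); (b) the number of pairs of integers $n>m\ge 0$ with $\max_{1\le i\le\ell}q_i(n)\le\max_{1\le i\le\ell}q_i(m)$ does not exceed $K$. For every $n\ge 1$ let $\Lambda_n=[l_n,r_n]$, $l_n\le r_n$, be an interval of integers and let $C_n^{(1)},\dots,C_n^{(\ell)}$ be cylinder sets on $\Lambda_n$. Put $$S_N=\sum_{n=1}^N\prod_{i=1}^\ell \mathbb 1_{C_n^{(i)}}\circ T^{q_i(n)},\qquad \mathcal E_N=\sum_{n=1}^N\prod_{i=1}^\ell P(C_n^{(i)}),$$ and assume that $\mathcal E_N\to\infty$ as $N\to\infty$. Let $D>0$ be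 a constant. **Theorem 2.3.** (i) If $\ell=1$, $\sum_{k\ge1}\phi(k)<\infty$, and $r_m<r_n+D$ for all $1\le m<n$ (that is, $\Lambda_m$ is right $D$-nested in $\Lambda_n$), then, with probability one, $S_N/\mathcal E_N\to 1$ as $N\to\infty$. (ii) If $\ell>1$, $\sum_{k\ge1}\psi(k)<\infty$, and $\Lambda_m\subset(l_n-D,\,r_n+D)$ for all $1\le m<n$ (that is, $\Lambda_m$ is $D$-nested in $\Lambda_n$), then, with probability one, $S_N/\mathcal E_N\to1$ as $N\to\infty$. -/

import Mathlib

open MeasureTheory Filter Topology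
open scoped ENNReal

noncomputable section

namespace ShiftBC

/-- The left shift `(T ω)_i = ω_{i+1}` on two-sided sequences. -/
def leftShift {A : Type*} (ω : ℤ → A) : ℤ → A := fun i => ω (i + 1)

/-- `C` is a cylinder set defined on the interval of integers `[l, r]`:
`C = {ω : ω_i = a_i for l ≤ i ≤ r}` (only the letters `a_l, …, a_r` matter). -/
def IsCylinderOn {A : Type*} (l r : ℤ) (C : Set (ℤ → A)) : Prop :=
  ∃ a : ℤ → A, C = {ω | ∀ i : ℤ, l ≤ i → i ≤ r → ω i = a i}

/-- The σ-algebra `F_{-∞,m}`, generated by the cylinders on intervals contained in `(-∞, m]`. -/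
@[reducible] def past (A : Type*) (m : ℤ) : MeasurableSpace (ℤ → A) :=
  MeasurableSpace.generateFrom {C | ∃ l r : ℤ, l ≤ r ∧ r ≤ m ∧ IsCylinderOn l r C}

/-- The σ-algebra `F_{m,∞}`, generated by the cylinders on intervals contained in `[m, ∞)`. -/
@[reducible] def future (A : Type*) (m : ℤ) : MeasurableSpace (ℤ → A) :=
  MeasurableSpace.generateFrom {C | ∃ l r : ℤ, l ≤ r ∧ m ≤ l ∧ IsCylinderOn l r C}

/-- The dependence coefficient `φ(G, H)` of two σ-algebras: the supremum of
`|P(Γ ∩ Δ) / P(Γ) - P(Δ)|` over `Γ ∈ G`, `Δ ∈ H` with `P(Γ) ≠ 0`. -/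
def phiDep {Ω : Type*} [MeasurableSpace Ω] (P : Measure Ω) (G H : MeasurableSpace Ω) : ℝ≥0∞ :=
  ⨆ (Γ : Set Ω) (Δ : Set Ω) (_ : MeasurableSet[G] Γ) (_ : MeasurableSet[H] Δ) (_ : P.real Γ ≠ 0),
    ENNReal.ofReal |P.real (Γ ∩ Δ) / P.real Γ - P.real Δ|

/-- The dependence coefficient `ψ(G, H)` of two σ-algebras: the supremum, possibly `∞`, of
`|P(Γ ∩ Δ) / (P(Γ) P(Δ)) - 1|` over `Γ ∈ G`, `Δ ∈ H` with `P(Γ) P(Δ) ≠ 0`. -/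
def psiDep {Ω : Type*} [MeasurableSpace Ω] (P : Measure Ω) (G H : MeasurableSpace Ω) : ℝ≥0∞ :=
  ⨆ (Γ : Set Ω) (Δ : Set Ω) (_ : MeasurableSet[G] Γ) (_ : MeasurableSet[H] Δ)
    (_ : P.real Γ * P.real Δ ≠ 0),
    ENNReal.ofReal |P.real (Γ ∩ Δ) / (P.real Γ * P.real Δ) - 1|

/-- `φ(k) = sup_m φ(F_{-∞,m}, F_{m+k,∞})`. -/
def phiCoeff {A : Type*} [MeasurableSpace A] (P : Measure (ℤ → A)) (k : ℕ) : ℝ≥0∞ :=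
  ⨆ m : ℤ, phiDep P (past A m) (future A (m + k))

/-- `ψ(k) = sup_m ψ(F_{-∞,m}, F_{m+k,∞})`. -/
def psiCoeff {A : Type*} [MeasurableSpace A] (P : Measure (ℤ → A)) (k : ℕ) : ℝ≥0∞ :=
  ⨆ m : ℤ, psiDep P (past A m) (future A (m + k))

/-- Summability of `φ` over `k ≥ 1` (as `φ ≤ 1`, including `φ(0)` would change nothing). -/
def PhiSummable {A : Type*} [MeasurableSpace A] (P : Measure (ℤ → A)) : Prop :=
  ∑' k : ℕ, phiCoeff P (k + 1) < ∞

/-- Summability of `ψ` over `k ≥ 1`; in particular `ψ(1) < ∞`. The value `ψ(0)`, which compares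
overlapping σ-algebras and is infinite for infinite alphabets, does not enter. -/
def PsiSummable {A : Type*} [MeasurableSpace A] (P : Measure (ℤ → A)) : Prop :=
  ∑' k : ℕ, psiCoeff P (k + 1) < ∞

/-- The standing assumption on the functions `q_1, …, q_ℓ`. The first clause concerns pairs of
distinct indices; the second one follows from it if `ℓ ≥ 2` and is what remains of it if `ℓ = 1`.
The third clause bounds the number of pairs `m < n` with `max_i q_i(n) ≤ max_i q_i(m)`. -/
def GrowthAssumption {ℓ : ℕ} (q : Fin ℓ → ℕ → ℕ) : Prop :=
  ∃ K : ℕ, 0 < K ∧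
    (∀ i j : Fin ℓ, i ≠ j → ∀ k : ℤ,
      {n : ℕ | (q i n : ℤ) - (q j n : ℤ) = k ∨ (q i n : ℤ) = k}.encard ≤ K) ∧
    (∀ (i : Fin ℓ) (k : ℤ), {n : ℕ | (q i n : ℤ) = k}.encard ≤ K) ∧
    {p : ℕ × ℕ | p.1 < p.2 ∧
      (Finset.univ.sup fun i => q i p.2) ≤ Finset.univ.sup fun i => q i p.1}.encard ≤ K

/-- `[l₁, r₁]` is right `D`-nested in `[l₂, r₂]`: `[l₁, r₁] ⊆ (-∞, r₂ + D)`. -/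
def RightNested (D : ℝ) (r₁ r₂ : ℤ) : Prop := (r₁ : ℝ) < r₂ + D

/-- `[l₁, r₁]` is `D`-nested in `[l₂, r₂]`: `[l₁, r₁] ⊆ (l₂ - D, r₂ + D)`. -/
def Nested (D : ℝ) (l₁ r₁ l₂ r₂ : ℤ) : Prop := (l₂ : ℝ) - D < l₁ ∧ (r₁ : ℝ) < r₂ + D

/-- `S_N(ω) = ∑_{n=1}^N ∏_i 1_{C_n^{(i)}}(T^{q_i(n)} ω)`. -/
def hitSum {A : Type*} {ℓ : ℕ} (q : Fin ℓ → ℕ → ℕ) (C : ℕ → Fin ℓ → Set (ℤ → A)) (N : ℕ)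
    (ω : ℤ → A) : ℝ :=
  ∑ n ∈ Finset.Icc 1 N, ∏ i, (C n i).indicator (fun _ => (1 : ℝ)) (leftShift^[q i n] ω)

/-- `E_N = ∑_{n=1}^N ∏_i P(C_n^{(i)})`. -/
def probSum {A : Type*} [MeasurableSpace A] (P : Measure (ℤ → A)) {ℓ : ℕ}
    (C : ℕ → Fin ℓ → Set (ℤ → A)) (N : ℕ) : ℝ :=
  ∑ n ∈ Finset.Icc 1 N, ∏ i, P.real (C n i)

end ShiftBC

end

namespace ShiftBC

/-! The proof is a second moment argument. If the mean square deviation of S_N from E_N is O(E_N),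
then along times where E is about k² the relative deviations have summable second moments, hence
vanish almost surely, and monotonicity fills in between (`ae_tendsto_occSum_div`). So only pair
correlations of the hit events U_n matter. With p_n the product of the cylinder probabilities,
`integral_occSum_sub_sq_le` says which errors are affordable: a factor 1 + η_m + η_n on p_m p_n with
Ση finite, and an additive p_m θ(m,n) with Σ_n θ(m,n) bounded uniformly in m.

For m < n there are three cases. If the largest shift fails to grow from m to n, the trivial bound
P(U_m) is used; there are at most K such pairs. If some shift at time n is close to one at time m,
compared with the window length, then the windows are long and the block with the largest shift at
time n sticks out to the right of all blocks at time m. Half of this overhang serves as a mixing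
gap, and the other half is a long cylinder, which is unlikely (`PhiMixing.exists_cylinder_bound`,
`PhiMixing.hitEvent_inter_le_of_close`). If all shifts are far apart, mixing gives independence up
to the rate at the gaps. Each such error is a summable function of some distance |q_i(n) - q_j(m)|,
a value taken by at most 2K times n, so the sum over n is bounded.

For several shifts the blocks of one event must also be separated from each other. Times at which
they are not have summable probability and are discarded (`ae_tendsto_occSum_div_of_restrict`). At
the others, the error from the gaps inside U_m does not decay in n, so it is affordable only as a
factor on p_m p_n; this is where ψ-mixing replaces φ-mixing. Cylinder decay fails only if some
letter has probability one; then the process is constant and S_N = E_N almost surely. -/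

/-- The number of the events `U 1, …, U N` that occur. -/
noncomputable def occSum {Ω : Type*} (U : ℕ → Set Ω) (N : ℕ) (ω : Ω) : ℝ :=
  ∑ n ∈ Finset.Icc 1 N, (U n).indicator (fun _ => (1 : ℝ)) ω

lemma occSum_nonneg {Ω : Type*} (U : ℕ → Set Ω) (N : ℕ) (ω : Ω) : 0 ≤ occSum U N ω :=
  Finset.sum_nonneg fun _ _ => Set.indicator_nonneg (fun _ _ => zero_le_one) _

lemma occSum_le {Ω : Type*} (U : ℕ → Set Ω) (N : ℕ) (ω : Ω) : occSum U N ω ≤ N := by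
  calc occSum U N ω ≤ ∑ n ∈ Finset.Icc 1 N, (1 : ℝ) :=
        Finset.sum_le_sum fun n _ => Set.indicator_le_self' (fun _ _ => zero_le_one) ω
    _ = N := by simp

/-! ### Strong law from a second moment bound. -/

section Probability

variable {Ω : Type*} [MeasurableSpace Ω] {P : Measure Ω}

/-- Nonnegative functions with summable integrals are almost surely summable. -/
lemma ae_summable_of_summable_integral {Y : ℕ → Ω → ℝ} (hY : ∀ k, Integrable (Y k) P)
    (h0 : ∀ k ω, 0 ≤ Y k ω) (hs : Summable fun k => ∫ ω, Y k ω ∂P) :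
    ∀ᵐ ω ∂P, Summable fun k => Y k ω := by
  have hfin : ∫⁻ ω, ∑' k, ENNReal.ofReal (Y k ω) ∂P ≠ ∞ := by
    rw [lintegral_tsum fun k => (hY k).aestronglyMeasurable.aemeasurable.ennreal_ofReal]
    have : ∀ k, ∫⁻ ω, ENNReal.ofReal (Y k ω) ∂P = ENNReal.ofReal (∫ ω, Y k ω ∂P) := fun k =>
      (ofReal_integral_eq_lintegral_ofReal (hY k) (ae_of_all _ (h0 k))).symm
    simp_rw [this]
    exact hs.tsum_ofReal_ne_top
  have hmeas : AEMeasurable (fun ω => ∑' k, ENNReal.ofReal (Y k ω)) P :=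
    AEMeasurable.tsum fun k => (hY k).aestronglyMeasurable.aemeasurable.ennreal_ofReal
  filter_upwards [ae_lt_top' hmeas hfin] with ω hω
  have := ENNReal.summable_toReal hω.ne
  simpa [ENNReal.toReal_ofReal (h0 _ ω)] using this

/-- Interpolation between the points of a subsequence along which `E` grows like `k ^ 2`. -/
lemma tendsto_div_of_subseq_sq {S E : ℕ → ℝ} (hS : Monotone S) (hS0 : ∀ n, 0 ≤ S n)
    (hEt : Tendsto E atTop atTop) {c : ℕ → ℕ}
    (hc : ∀ k N, c k ≤ N ↔ (k : ℝ) ^ 2 ≤ E N) (hc' : ∀ k, E (c k) ≤ (k : ℝ) ^ 2 + 1)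
    (h : Tendsto (fun k => S (c k) / E (c k)) atTop (𝓝 1)) :
    Tendsto (fun N => S N / E N) atTop (𝓝 1) := by
  set κ : ℕ → ℕ := fun N => ⌊√(E N)⌋₊ with hκ
  have hκt : Tendsto κ atTop atTop :=
    tendsto_nat_floor_atTop.comp (Real.tendsto_sqrt_atTop.comp hEt)
  have hlow : ∀ᶠ N in atTop, (κ N : ℝ) ^ 2 ≤ E N := by
    filter_upwards [hEt.eventually_ge_atTop 0] with N hN
    have h1 : (κ N : ℝ) ≤ √(E N) := Nat.floor_le (Real.sqrt_nonneg _)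
    calc (κ N : ℝ) ^ 2 ≤ √(E N) ^ 2 := by gcongr
      _ = E N := Real.sq_sqrt hN
  have hup : ∀ᶠ N in atTop, E N ≤ ((κ N + 1 : ℕ) : ℝ) ^ 2 := by
    filter_upwards [hEt.eventually_ge_atTop 0] with N hN
    have h1 : √(E N) < κ N + 1 := Nat.lt_floor_add_one _
    calc E N = √(E N) ^ 2 := (Real.sq_sqrt hN).symm
      _ ≤ ((κ N + 1 : ℕ) : ℝ) ^ 2 := by push_cast; gcongr
  have hge : ∀ k : ℕ, (k : ℝ) ^ 2 ≤ E (c k) := fun k => (hc k _).1 le_rfl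
  have hk1 : Tendsto (fun k : ℕ => ((k : ℝ) ^ 2) / (((k + 1 : ℕ) : ℝ) ^ 2 + 1)) atTop (𝓝 1) := by
    have h1 : Tendsto (fun k : ℕ => 1 / (((1 : ℝ) + (k : ℝ)⁻¹) ^ 2 + ((k : ℝ)⁻¹) ^ 2)) atTop
        (𝓝 (1 / ((1 + 0) ^ 2 + 0 ^ 2))) := by
      have := tendsto_inv_atTop_nhds_zero_nat (𝕜 := ℝ)
      refine Tendsto.div tendsto_const_nhds
        (((tendsto_const_nhds.add this).pow 2).add (this.pow 2)) (by norm_num)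
    simp only [add_zero, one_pow, ne_eq, OfNat.ofNat_ne_zero, not_false_eq_true, zero_pow,
      div_one] at h1
    refine h1.congr' ?_
    filter_upwards [eventually_gt_atTop 0] with k hk
    have : (0 : ℝ) < k := by exact_mod_cast hk
    push_cast
    field_simp
  have hk2 : Tendsto (fun k : ℕ => (((k + 1 : ℕ) : ℝ) ^ 2 + 1) / ((k : ℝ) ^ 2)) atTop (𝓝 1) := by
    have := hk1.inv₀ one_ne_zero
    simpa using this
  have hL : Tendsto (fun k : ℕ => S (c k) / E (c k) *
      (((k : ℝ) ^ 2) / (((k + 1 : ℕ) : ℝ) ^ 2 + 1))) atTop (𝓝 1) := by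
    simpa using h.mul hk1
  have hU : Tendsto (fun k : ℕ => S (c (k + 1)) / E (c (k + 1)) *
      ((((k + 1 : ℕ) : ℝ) ^ 2 + 1) / ((k : ℝ) ^ 2))) atTop (𝓝 1) := by
    simpa using (h.comp (tendsto_add_atTop_nat 1)).mul hk2
  refine tendsto_of_tendsto_of_tendsto_of_le_of_le' (hL.comp hκt) (hU.comp hκt) ?_ ?_
  · filter_upwards [hlow, hup, hκt.eventually_gt_atTop 0] with N h1 h2 h3
    simp only [Function.comp_apply]
    have hk0 : (0 : ℝ) < (κ N : ℝ) ^ 2 := by positivity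
    have hN0 : 0 < E N := hk0.trans_le h1
    have hcN : c (κ N) ≤ N := (hc _ _).2 h1
    have he : 0 < E (c (κ N)) := hk0.trans_le (hge _)
    calc S (c (κ N)) / E (c (κ N)) * ((κ N : ℝ) ^ 2 / (((κ N + 1 : ℕ) : ℝ) ^ 2 + 1))
        ≤ S (c (κ N)) / E (c (κ N)) * (E (c (κ N)) / E N) := by
          refine mul_le_mul_of_nonneg_left ?_ (div_nonneg (hS0 _) he.le)
          refine div_le_div₀ he.le (hge _) hN0 (h2.trans (by linarith))
      _ = S (c (κ N)) / E N := by field_simp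
      _ ≤ S N / E N := by gcongr; exact hS hcN
  · filter_upwards [hlow, hup, hκt.eventually_gt_atTop 0] with N h1 h2 h3
    simp only [Function.comp_apply]
    have hk0 : (0 : ℝ) < (κ N : ℝ) ^ 2 := by positivity
    have hN0 : 0 < E N := hk0.trans_le h1
    have he : 0 < E (c (κ N + 1)) := lt_of_lt_of_le (by positivity) (hge _)
    have hNc : N ≤ c (κ N + 1) := by
      by_contra! hlt
      have hlt' : (((κ N + 1 : ℕ) : ℝ)) ^ 2 ≤ E N := (hc _ _).1 hlt.le
      have h4 : √(E N) < κ N + 1 := Nat.lt_floor_add_one _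
      have h5 : ((κ N : ℝ) + 1) ≤ √(E N) := Real.le_sqrt_of_sq_le (by exact_mod_cast hlt')
      linarith
    calc S N / E N ≤ S (c (κ N + 1)) / E N := by gcongr; exact hS hNc
      _ = S (c (κ N + 1)) / E (c (κ N + 1)) * (E (c (κ N + 1)) / E N) := by field_simp
      _ ≤ _ := by
          refine mul_le_mul_of_nonneg_left ?_ (div_nonneg (hS0 _) he.le)
          exact div_le_div₀ (by positivity) (hc' _) hk0 h1

lemma sum_Icc_one_monotone {f : ℕ → ℝ} (h0 : ∀ n, 0 ≤ f n) :
    Monotone fun N => ∑ n ∈ Finset.Icc 1 N, f n := fun _ _ h =>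
  Finset.sum_le_sum_of_subset_of_nonneg (Finset.Icc_subset_Icc_right h) fun i _ _ => h0 i

lemma measurable_occSum {U : ℕ → Set Ω} (hU : ∀ n, MeasurableSet (U n)) (N : ℕ) :
    Measurable (occSum U N) :=
  Finset.measurable_sum _ fun n _ => measurable_const.indicator (hU n)

lemma integrable_occSum_sub_sq [IsFiniteMeasure P] {U : ℕ → Set Ω} (hU : ∀ n, MeasurableSet (U n))
    (N : ℕ) (x : ℝ) : Integrable (fun ω => (occSum U N ω - x) ^ 2) P := by
  refine Integrable.of_bound
    (((measurable_occSum hU N).sub_const x).pow_const 2).aestronglyMeasurable ((N + |x|) ^ 2)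
    (ae_of_all _ fun ω => ?_)
  rw [norm_pow, Real.norm_eq_abs]
  gcongr
  refine (abs_sub _ _).trans ?_
  rw [abs_of_nonneg (occSum_nonneg U N ω)]
  gcongr
  exact occSum_le U N ω

/-- A strong Borel–Cantelli lemma: a mean square deviation of the order of the mean suffices. -/
theorem ae_tendsto_occSum_div [IsProbabilityMeasure P] {U : ℕ → Set Ω}
    (hU : ∀ n, MeasurableSet (U n)) {p : ℕ → ℝ} (hp0 : ∀ n, 0 ≤ p n) (hp1 : ∀ n, p n ≤ 1)
    (hE : Tendsto (fun N => ∑ n ∈ Finset.Icc 1 N, p n) atTop atTop) {C : ℝ}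
    (hvar : ∀ N, ∫ ω, (occSum U N ω - ∑ n ∈ Finset.Icc 1 N, p n) ^ 2 ∂P ≤
      C * ∑ n ∈ Finset.Icc 1 N, p n) :
    ∀ᵐ ω ∂P, Tendsto (fun N => occSum U N ω / ∑ n ∈ Finset.Icc 1 N, p n) atTop (𝓝 1) := by
  set E : ℕ → ℝ := fun N => ∑ n ∈ Finset.Icc 1 N, p n with hEdef
  have hEm : Monotone E := sum_Icc_one_monotone hp0
  have hex : ∀ k : ℕ, ∃ N, (k : ℝ) ^ 2 ≤ E N := fun k =>
    (hE.eventually_ge_atTop ((k : ℝ) ^ 2)).exists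
  classical
  set c : ℕ → ℕ := fun k => Nat.find (hex k) with hcdef
  have hcs : ∀ k : ℕ, (k : ℝ) ^ 2 ≤ E (c k) := fun k => Nat.find_spec (hex k)
  have hc : ∀ k N, c k ≤ N ↔ (k : ℝ) ^ 2 ≤ E N := fun k N =>
    ⟨fun h => (hcs k).trans (hEm h), fun h => Nat.find_min' (hex k) h⟩
  -- `c k` is the first time at which E reaches k²; the overshoot is at most one term, hence at most
  -- 1.
  have hc' : ∀ k, E (c k) ≤ (k : ℝ) ^ 2 + 1 := by
    intro k
    rcases Nat.eq_zero_or_pos (c k) with h0 | hpos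
    · rw [h0]
      simp only [hEdef, Finset.Icc_eq_empty_of_lt zero_lt_one, Finset.sum_empty]
      positivity
    · obtain ⟨j, hj⟩ := Nat.exists_eq_succ_of_ne_zero hpos.ne'
      have hlt : E j < (k : ℝ) ^ 2 := by
        by_contra! hle
        have := (hc k j).2 hle
        omega
      have : E (c k) = E j + p (j + 1) := by
        rw [hj]
        simp only [hEdef, Nat.succ_eq_add_one]
        rw [Finset.sum_Icc_succ_top (by omega)]
      linarith [hp1 (j + 1)]
  -- The relative second moment is at most |C| / E, and E is at least (k + 1)² here. Starting at k +
  -- 1 keeps the denominator positive.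
  have hsum : Summable fun k : ℕ => ∫ ω, ((occSum U (c (k + 1)) ω - E (c (k + 1))) /
      E (c (k + 1))) ^ 2 ∂P := by
    have hs : Summable fun k : ℕ => |C| * (1 / ((k + 1 : ℕ) : ℝ) ^ 2) :=
      ((summable_nat_add_iff 1).2 (Real.summable_one_div_nat_pow.2 one_lt_two)).mul_left _
    refine Summable.of_nonneg_of_le (fun k => integral_nonneg fun ω => by positivity)
      (fun k => ?_) hs
    have hk := hcs (k + 1)
    have hk0 : (0 : ℝ) < ((k + 1 : ℕ) : ℝ) ^ 2 := by positivity
    have he : 0 < E (c (k + 1)) := hk0.trans_le hk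
    simp_rw [div_pow]
    rw [integral_div]
    calc _ ≤ (|C| * E (c (k + 1))) / E (c (k + 1)) ^ 2 := by
          gcongr
          exact (hvar _).trans (by gcongr; exact le_abs_self C)
      _ = |C| * (1 / E (c (k + 1))) := by field_simp
      _ ≤ _ := by gcongr
  have hae := ae_summable_of_summable_integral (P := P)
    (fun k => by
      simp_rw [div_pow]
      exact (integrable_occSum_sub_sq hU _ _).div_const _) (fun k ω => by positivity) hsum
  filter_upwards [hae] with ω hω
  refine tendsto_div_of_subseq_sq
    (sum_Icc_one_monotone fun n => Set.indicator_nonneg (fun _ _ => zero_le_one) ω)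
    (fun n => occSum_nonneg U n ω) hE hc hc' ?_
  rw [← tendsto_add_atTop_iff_nat 1]
  have h1 : Tendsto (fun k : ℕ => (occSum U (c (k + 1)) ω - E (c (k + 1))) /
      E (c (k + 1))) atTop (𝓝 0) := by
    have := hω.tendsto_atTop_zero
    have h2 := this.sqrt
    simp only [Real.sqrt_sq_eq_abs, Real.sqrt_zero] at h2
    exact (tendsto_zero_iff_abs_tendsto_zero _).2 h2
  have h2 := h1.add_const 1
  rw [zero_add] at h2
  refine h2.congr fun k => ?_
  have he : E (c (k + 1)) ≠ 0 :=
    (lt_of_lt_of_le (by positivity : (0 : ℝ) < ((k + 1 : ℕ) : ℝ) ^ 2) (hcs (k + 1))).ne'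
  rw [sub_div]
  exact (congrArg (· + 1) (congrArg _ (div_self he))).trans (sub_add_cancel _ _)

/-- The mean square deviation of the number of occurring events from its approximate mean. -/
lemma integral_occSum_sub_sq_le [IsProbabilityMeasure P] {U : ℕ → Set Ω}
    (hU : ∀ n, MeasurableSet (U n)) {p η : ℕ → ℝ} {θ : ℕ → ℕ → ℝ} {C : ℝ}
    (hp0 : ∀ n, 0 ≤ p n) (hp1 : ∀ n, p n ≤ 1) (hη0 : ∀ n, 0 ≤ η n) (hθ0 : ∀ m n, 0 ≤ θ m n)
    (hup : ∀ n, P.real (U n) ≤ C * p n) (hlow : ∀ n, p n * (1 - η n) ≤ P.real (U n))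
    (hpair : ∀ m n, m < n →
      P.real (U m ∩ U n) ≤ p m * p n * (1 + η m + η n) + p m * θ m n)
    (hη : ∀ N, ∑ n ∈ Finset.Icc 1 N, η n ≤ C) (hθ : ∀ m N, ∑ n ∈ Finset.Icc 1 N, θ m n ≤ C)
    (N : ℕ) :
    ∫ ω, (occSum U N ω - ∑ n ∈ Finset.Icc 1 N, p n) ^ 2 ∂P ≤
      (7 * C + 1) * ∑ n ∈ Finset.Icc 1 N, p n := by
  set X : ℕ → Ω → ℝ := fun n => (U n).indicator fun _ => (1 : ℝ) with hX
  have hXi : ∀ n, Integrable (X n) P := fun n => (integrable_const 1).indicator (hU n)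
  have hXX : ∀ m n ω, X m ω * X n ω = (U m ∩ U n).indicator (fun _ => (1 : ℝ)) ω := by
    intro m n ω
    by_cases h1 : ω ∈ U m <;> by_cases h2 : ω ∈ U n <;> simp [hX, h1, h2]
  have hXXi : ∀ m n, Integrable (fun ω => X m ω * X n ω) P := by
    intro m n
    simp_rw [hXX]
    exact (integrable_const 1).indicator ((hU m).inter (hU n))
  have hXint : ∀ n, ∫ ω, X n ω ∂P = P.real (U n) := fun n => by
    simp only [hX]
    rw [integral_indicator_const _ (hU n)]
    simp
  have hXXint : ∀ m n, ∫ ω, X m ω * X n ω ∂P = P.real (U m ∩ U n) := fun m n => by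
    simp_rw [hXX]
    rw [integral_indicator_const _ ((hU m).inter (hU n))]
    simp
  set c : ℕ → ℕ → ℝ := fun m n =>
    P.real (U m ∩ U n) - p m * P.real (U n) - p n * P.real (U m) + p m * p n with hc
  have hci : ∀ m n, Integrable (fun ω => (X m ω - p m) * (X n ω - p n)) P := by
    intro m n
    have : (fun ω => (X m ω - p m) * (X n ω - p n)) = fun ω =>
        X m ω * X n ω - p m * X n ω - p n * X m ω + p m * p n := by
      ext ω; ring
    rw [this]
    exact (((hXXi m n).sub ((hXi n).const_mul _)).sub ((hXi m).const_mul _)).add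
      (integrable_const _)
  have hcint : ∀ m n, ∫ ω, (X m ω - p m) * (X n ω - p n) ∂P = c m n := by
    intro m n
    have : (fun ω => (X m ω - p m) * (X n ω - p n)) = fun ω =>
        X m ω * X n ω - p m * X n ω - p n * X m ω + p m * p n := by
      ext ω; ring
    have i1 : Integrable (fun ω => X m ω * X n ω - p m * X n ω) P :=
      (hXXi m n).sub ((hXi n).const_mul _)
    have i2 : Integrable (fun ω => X m ω * X n ω - p m * X n ω - p n * X m ω) P :=
      i1.sub ((hXi m).const_mul _)
    rw [this, integral_add i2 (integrable_const _), integral_sub i1 ((hXi m).const_mul _),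
      integral_sub (hXXi m n) ((hXi n).const_mul _),
      integral_const_mul, integral_const_mul, hXXint, hXint, hXint]
    simp [hc]
  have hexp : ∫ ω, (occSum U N ω - ∑ n ∈ Finset.Icc 1 N, p n) ^ 2 ∂P =
      ∑ m ∈ Finset.Icc 1 N, ∑ n ∈ Finset.Icc 1 N, c m n := by
    have : (fun ω => (occSum U N ω - ∑ n ∈ Finset.Icc 1 N, p n) ^ 2) = fun ω =>
        ∑ m ∈ Finset.Icc 1 N, ∑ n ∈ Finset.Icc 1 N, (X m ω - p m) * (X n ω - p n) := by
      ext ω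
      rw [occSum, ← Finset.sum_sub_distrib, sq, Finset.sum_mul_sum]
    rw [this, integral_finsetSum _ fun m _ => integrable_finsetSum _ fun n _ => hci m n]
    refine Finset.sum_congr rfl fun m _ => ?_
    rw [integral_finsetSum _ fun n _ => hci m n]
    exact Finset.sum_congr rfl fun n _ => hcint m n
  have hsymm : ∀ m n, c m n = c n m := fun m n => by
    simp only [hc, Set.inter_comm (U m)]; ring
  -- The main terms p_m p_n cancel: both cross terms are bounded below by p_m p_n up to η, so only
  -- twice the relative error survives.
  have hlt : ∀ m n, m < n → c m n ≤ 2 * (p m * p n * (η m + η n)) + p m * θ m n := by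
    intro m n hmn
    have h1 := hpair m n hmn
    have h2 := mul_le_mul_of_nonneg_left (hlow n) (hp0 m)
    have h3 := mul_le_mul_of_nonneg_left (hlow m) (hp0 n)
    simp only [hc]
    nlinarith
  have hall : ∀ m n, c m n ≤ 2 * (p m * p n * (η m + η n)) + p m * θ m n + p n * θ n m +
      (if m = n then (C + 1) * p m else 0) := by
    intro m n
    have hz1 := mul_nonneg (hp0 m) (hθ0 m n)
    have hz2 := mul_nonneg (hp0 n) (hθ0 n m)
    rcases lt_trichotomy m n with h | h | h
    · rw [if_neg h.ne]; linarith [hlt m n h]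
    · subst h
      rw [if_pos rfl]
      have h1 : 0 ≤ p m * p m * (η m + η m) :=
        mul_nonneg (mul_nonneg (hp0 m) (hp0 m)) (add_nonneg (hη0 m) (hη0 m))
      have h2 : 0 ≤ p m * P.real (U m) := mul_nonneg (hp0 m) measureReal_nonneg
      have h3 : p m * p m ≤ p m := mul_le_of_le_one_left (hp0 m) (hp1 m)
      simp only [hc, Set.inter_self]
      linarith [hup m]
    · rw [if_neg h.ne', hsymm]
      have := hlt n m h
      nlinarith
  rw [hexp]
  set s := Finset.Icc 1 N with hs
  -- In Σ p_m p_n η_n one factor p_n is given up to use Ση ≤ C; the other still yields E_N, so the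
  -- bound is linear in E_N.
  have hpη : ∑ n ∈ s, p n * η n ≤ C :=
    (Finset.sum_le_sum fun n _ => mul_le_of_le_one_left (hη0 n) (hp1 n)).trans (hη N)
  have hEs : 0 ≤ ∑ n ∈ s, p n := Finset.sum_nonneg fun n _ => hp0 n
  calc ∑ m ∈ s, ∑ n ∈ s, c m n
      ≤ ∑ m ∈ s, ∑ n ∈ s, (2 * (p m * p n * (η m + η n)) + p m * θ m n + p n * θ n m +
      (if m = n then (C + 1) * p m else 0)) :=
        Finset.sum_le_sum fun m _ => Finset.sum_le_sum fun n _ => hall m n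
    _ = 4 * ((∑ n ∈ s, p n * η n) * ∑ n ∈ s, p n) + 2 * ∑ m ∈ s, p m * ∑ n ∈ s, θ m n +
        (C + 1) * ∑ n ∈ s, p n := by
      simp_rw [Finset.sum_add_distrib]
      have e1 : ∑ m ∈ s, ∑ n ∈ s, 2 * (p m * p n * (η m + η n)) =
          4 * ((∑ n ∈ s, p n * η n) * ∑ n ∈ s, p n) := by
        have : ∀ m n, 2 * (p m * p n * (η m + η n)) =
            2 * ((p m * η m) * p n) + 2 * (p m * (p n * η n)) := fun m n => by ring
        simp_rw [this, Finset.sum_add_distrib, ← Finset.mul_sum, ← Finset.sum_mul]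
        ring
      have e2 : ∑ m ∈ s, ∑ n ∈ s, p n * θ n m = ∑ m ∈ s, p m * ∑ n ∈ s, θ m n := by
        rw [Finset.sum_comm]
        simp_rw [Finset.mul_sum]
      have e3 : ∑ m ∈ s, ∑ n ∈ s, (if m = n then (C + 1) * p m else 0) =
          (C + 1) * ∑ n ∈ s, p n := by
        rw [Finset.mul_sum]
        refine Finset.sum_congr rfl fun m hm => ?_
        rw [Finset.sum_ite_eq, if_pos hm]
      have e4 : ∑ m ∈ s, ∑ n ∈ s, p m * θ m n = ∑ m ∈ s, p m * ∑ n ∈ s, θ m n := by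
        simp_rw [Finset.mul_sum]
      rw [e1, e2, e3, e4]
      ring
    _ ≤ 4 * (C * ∑ n ∈ s, p n) + 2 * ∑ m ∈ s, p m * C + (C + 1) * ∑ n ∈ s, p n := by
      gcongr with m hm
      · exact hp0 m
      · exact hθ m N
    _ = _ := by
      rw [← Finset.sum_mul]; ring

end Probability

/-! ### Summation along maps with bounded fibres. -/

section Counting

/-- A reindexing whose fibres have at most `K` elements increases sums by a factor at most `K`. -/
lemma sum_comp_le {d : ℕ → ℕ} {K : ℕ} (hd : ∀ k, {n | d n = k}.encard ≤ K) {F : ℕ → ℝ}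
    (hF0 : ∀ k, 0 ≤ F k) (hF : Summable F) (s : Finset ℕ) :
    ∑ n ∈ s, F (d n) ≤ K * ∑' k, F k := by
  classical
  have hcard : ∀ k, ((s.filter fun n => d n = k).card : ℝ) ≤ K := by
    intro k
    have h1 : ((s.filter fun n => d n = k : Finset ℕ) : Set ℕ).encard ≤ K :=
      (Set.encard_le_encard fun n hn => by simpa using (Finset.mem_filter.1 hn).2).trans (hd k)
    rw [Set.encard_coe_eq_coe_finsetCard] at h1
    exact_mod_cast h1
  calc ∑ n ∈ s, F (d n) = ∑ k ∈ s.image d, ∑ n ∈ s with d n = k, F (d n) :=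
        (Finset.sum_fiberwise_of_maps_to (fun n hn => Finset.mem_image_of_mem d hn) _).symm
    _ = ∑ k ∈ s.image d, ((s.filter fun n => d n = k).card : ℝ) * F k := by
        refine Finset.sum_congr rfl fun k _ => ?_
        rw [Finset.sum_congr rfl fun n hn => by rw [(Finset.mem_filter.1 hn).2],
          Finset.sum_const, nsmul_eq_mul]
    _ ≤ ∑ k ∈ s.image d, K * F k :=
        Finset.sum_le_sum fun k _ => mul_le_mul_of_nonneg_right (hcard k) (hF0 k)
    _ = K * ∑ k ∈ s.image d, F k := by rw [Finset.mul_sum]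
    _ ≤ K * ∑' k, F k := by
        gcongr
        exact hF.sum_le_tsum _ fun k _ => hF0 k

lemma summable_comp_half {F : ℕ → ℝ} (hF0 : ∀ k, 0 ≤ F k) (hF : Summable F) :
    Summable fun n => F (n / 2) := by
  refine summable_of_sum_le (c := (2 : ℕ) * ∑' k, F k) (fun n => hF0 _) fun s => ?_
  refine sum_comp_le (d := fun n => n / 2) (fun k => ?_) hF0 hF s
  have : {n : ℕ | n / 2 = k} ⊆ {2 * k, 2 * k + 1} := fun n hn => by
    simp only [Set.mem_ofPred_eq] at hn
    simp only [Set.mem_insert_iff, Set.mem_singleton_iff]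
    omega
  exact (Set.encard_le_encard this).trans
    ((Set.encard_insert_le _ _).trans (by rw [Set.encard_singleton]; norm_num))

lemma encard_natAbs_fiber_le {f : ℕ → ℤ} {K : ℕ} (hf : ∀ k : ℤ, {n | f n = k}.encard ≤ K)
    (k : ℕ) : {n | (f n).natAbs = k}.encard ≤ (2 * K : ℕ) := by
  have : {n | (f n).natAbs = k} ⊆ {n | f n = k} ∪ {n | f n = -k} := fun n hn => by
    simp only [Set.mem_ofPred_eq] at hn
    simp only [Set.mem_union, Set.mem_ofPred_eq]
    omega
  calc _ ≤ _ := Set.encard_le_encard this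
    _ ≤ _ := Set.encard_union_le _ _
    _ ≤ K + K := add_le_add (hf _) (hf _)
    _ = (2 * K : ℕ) := by push_cast; ring

end Counting

/-! ### Cylinder sets under the shift. -/

section Cylinders

variable {A : Type*}

lemma leftShift_iterate (k : ℕ) (ω : ℤ → A) (i : ℤ) : leftShift^[k] ω i = ω (i + k) := by
  induction k generalizing ω with
  | zero => simp
  | succ k ih =>
    rw [Function.iterate_succ_apply, ih, leftShift]
    congr 1
    push_cast
    ring

lemma IsCylinderOn.preimage_iterate {l r : ℤ} {C : Set (ℤ → A)} (h : IsCylinderOn l r C) (k : ℕ) :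
    IsCylinderOn (l + k) (r + k) (leftShift^[k] ⁻¹' C) := by
  obtain ⟨a, rfl⟩ := h
  refine ⟨fun i => a (i - k), ?_⟩
  ext ω
  simp only [Set.mem_preimage, Set.mem_ofPred_eq, leftShift_iterate]
  constructor
  · intro h i h1 h2
    have := h (i - k) (by omega) (by omega)
    simpa using this
  · intro h i h1 h2
    have := h (i + k) (by omega) (by omega)
    simpa using this

lemma IsCylinderOn.exists_superset {l r : ℤ} {C : Set (ℤ → A)} (h : IsCylinderOn l r C)
    {l' r' : ℤ} (hl : l ≤ l') (hr : r' ≤ r) : ∃ C', C ⊆ C' ∧ IsCylinderOn l' r' C' := by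
  obtain ⟨a, rfl⟩ := h
  exact ⟨{ω | ∀ i, l' ≤ i → i ≤ r' → ω i = a i},
    fun ω hω i h1 h2 => hω i (hl.trans h1) (h2.trans hr), a, rfl⟩

lemma IsCylinderOn.measurableSet_past {l r m : ℤ} {C : Set (ℤ → A)} (h : IsCylinderOn l r C)
    (hlr : l ≤ r) (hm : r ≤ m) : MeasurableSet[past A m] C :=
  MeasurableSpace.measurableSet_generateFrom ⟨l, r, hlr, hm, h⟩

lemma IsCylinderOn.measurableSet_future {l r m : ℤ} {C : Set (ℤ → A)} (h : IsCylinderOn l r C)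
    (hlr : l ≤ r) (hm : m ≤ l) : MeasurableSet[future A m] C :=
  MeasurableSpace.measurableSet_generateFrom ⟨l, r, hlr, hm, h⟩

lemma isCylinderOn_letter (i : ℤ) (x : A) : IsCylinderOn i i {ω : ℤ → A | ω i = x} :=
  ⟨fun _ => x, by
    ext ω
    exact ⟨fun hω j h1 h2 => by rw [le_antisymm h2 h1]; exact hω, fun hω => hω i le_rfl le_rfl⟩⟩

lemma future_anti {m m' : ℤ} (h : m ≤ m') : future A m' ≤ future A m :=
  MeasurableSpace.generateFrom_mono fun _ ⟨l, r, h1, h2, h3⟩ => ⟨l, r, h1, h.trans h2, h3⟩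

variable [MeasurableSpace A] [MeasurableSingletonClass A]

lemma IsCylinderOn.measurableSet {l r : ℤ} {C : Set (ℤ → A)} (h : IsCylinderOn l r C) :
    MeasurableSet C := by
  obtain ⟨a, rfl⟩ := h
  have : {ω : ℤ → A | ∀ i, l ≤ i → i ≤ r → ω i = a i} =
      ⋂ i : ℤ, ⋂ _ : l ≤ i, ⋂ _ : i ≤ r, (fun ω : ℤ → A => ω i) ⁻¹' {a i} := by
    ext ω; simp
  rw [this]
  exact MeasurableSet.iInter fun i => MeasurableSet.iInter fun _ => MeasurableSet.iInter fun _ =>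
    measurable_pi_apply i (measurableSet_singleton _)

variable {P : Measure (ℤ → A)}

lemma IsCylinderOn.measureReal_preimage {l r : ℤ} {C : Set (ℤ → A)} (h : IsCylinderOn l r C)
    (hT : MeasurePreserving (leftShift (A := A)) P P) (k : ℕ) :
    P.real (leftShift^[k] ⁻¹' C) = P.real C := by
  rw [measureReal_def, measureReal_def,
    (hT.iterate k).measure_preimage h.measurableSet.nullMeasurableSet]

lemma measureReal_letter (hT : MeasurePreserving (leftShift (A := A)) P P) (i : ℤ) (x : A) :
    P.real {ω | ω i = x} = P.real {ω | ω 0 = x} := by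
  rcases le_or_gt 0 i with hi | hi
  · have hpre : {ω : ℤ → A | ω i = x} = leftShift^[i.toNat] ⁻¹' {ω | ω 0 = x} := by
      ext ω
      simp only [Set.mem_ofPred_eq, Set.mem_preimage, leftShift_iterate]
      rw [zero_add, Int.toNat_of_nonneg hi]
    rw [hpre, (isCylinderOn_letter 0 x).measureReal_preimage hT]
  · have hpre : {ω : ℤ → A | ω 0 = x} = leftShift^[(-i).toNat] ⁻¹' {ω | ω i = x} := by
      ext ω
      simp only [Set.mem_ofPred_eq, Set.mem_preimage, leftShift_iterate]
      rw [Int.toNat_of_nonneg (by omega), add_neg_cancel]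
    rw [hpre, (isCylinderOn_letter i x).measureReal_preimage hT]

end Cylinders

/-! ### Mixing rates and the decay of cylinder probabilities. -/

section Mixing

variable {A : Type*} [MeasurableSpace A]

/-- Uniform mixing with rate `a k` across a gap of `k + 1`. -/
def PhiMixing (P : Measure (ℤ → A)) (a : ℕ → ℝ) : Prop :=
  ∀ (m m' : ℤ) (k : ℕ) (Γ Δ : Set (ℤ → A)), m + k + 1 ≤ m' → MeasurableSet[past A m] Γ →
    MeasurableSet[future A m'] Δ → |P.real (Γ ∩ Δ) - P.real Γ * P.real Δ| ≤ a k * P.real Γ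

/-- `ψ`-mixing with rate `a k` across a gap of `k + 1`. -/
def PsiMixing (P : Measure (ℤ → A)) (a : ℕ → ℝ) : Prop :=
  ∀ (m m' : ℤ) (k : ℕ) (Γ Δ : Set (ℤ → A)), m + k + 1 ≤ m' → MeasurableSet[past A m] Γ →
    MeasurableSet[future A m'] Δ →
      |P.real (Γ ∩ Δ) - P.real Γ * P.real Δ| ≤ a k * (P.real Γ * P.real Δ)

variable {P : Measure (ℤ → A)}

lemma PsiMixing.phiMixing [IsProbabilityMeasure P]
    {a : ℕ → ℝ} (h : PsiMixing P a) (ha : ∀ k, 0 ≤ a k) : PhiMixing P a :=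
  fun m m' k Γ Δ hm hΓ hΔ => (h m m' k Γ Δ hm hΓ hΔ).trans <| by
    gcongr
    · exact ha k
    · exact mul_le_of_le_one_right measureReal_nonneg measureReal_le_one

/-- A wider gap leaves a smaller future σ-algebra, so the supremum runs over fewer sets. -/
lemma psiCoeff_antitone : Antitone (psiCoeff P) := by
  intro k k' h
  refine iSup_mono fun m => iSup_mono fun Γ => iSup_mono fun Δ => iSup_mono fun _ =>
    iSup_mono' fun hΔ => ⟨?_, le_rfl⟩
  exact future_anti (by omega) _ hΔ

lemma PhiSummable.exists_phiMixing [IsFiniteMeasure P] (h : PhiSummable P) :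
    ∃ a : ℕ → ℝ, (∀ k, 0 ≤ a k) ∧ Summable a ∧ PhiMixing P a := by
  have hne : ∀ k, phiCoeff P (k + 1) ≠ ∞ := fun k => ENNReal.ne_top_of_tsum_ne_top h.ne k
  refine ⟨fun k => (phiCoeff P (k + 1)).toReal, fun k => ENNReal.toReal_nonneg,
    ENNReal.summable_toReal h.ne, ?_⟩
  intro m m' k Γ Δ hm hΓ hΔ
  by_cases h0 : P.real Γ = 0
  · have : P.real (Γ ∩ Δ) = 0 :=
      le_antisymm (h0 ▸ measureReal_mono Set.inter_subset_left) measureReal_nonneg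
    simp [h0, this]
  have hpos : 0 < P.real Γ := lt_of_le_of_ne measureReal_nonneg (Ne.symm h0)
  have h1 : ENNReal.ofReal |P.real (Γ ∩ Δ) / P.real Γ - P.real Δ| ≤ phiCoeff P (k + 1) := by
    refine le_iSup_of_le m (le_iSup_of_le Γ (le_iSup_of_le Δ (le_iSup_of_le hΓ
      (le_iSup_of_le ?_ (le_iSup_of_le h0 le_rfl)))))
    exact future_anti (by push_cast; omega) _ hΔ
  have h2 := (ENNReal.ofReal_le_iff_le_toReal (hne k)).1 h1
  calc _ = |P.real (Γ ∩ Δ) / P.real Γ - P.real Δ| * P.real Γ := by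
        rw [← abs_of_pos hpos, ← abs_mul, abs_of_pos hpos]
        congr 1
        field_simp
    _ ≤ _ := by gcongr

lemma PsiSummable.exists_psiMixing [IsFiniteMeasure P] (h : PsiSummable P) :
    ∃ a : ℕ → ℝ, (∀ k, 0 ≤ a k) ∧ Antitone a ∧ Summable a ∧ PsiMixing P a := by
  have hne : ∀ k, psiCoeff P (k + 1) ≠ ∞ := fun k => ENNReal.ne_top_of_tsum_ne_top h.ne k
  refine ⟨fun k => (psiCoeff P (k + 1)).toReal, fun k => ENNReal.toReal_nonneg, fun k k' hk =>
    ENNReal.toReal_mono (hne k) (psiCoeff_antitone (by omega)), ENNReal.summable_toReal h.ne, ?_⟩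
  intro m m' k Γ Δ hm hΓ hΔ
  by_cases h0 : P.real Γ * P.real Δ = 0
  · have : P.real (Γ ∩ Δ) = 0 := by
      refine le_antisymm ?_ measureReal_nonneg
      rcases mul_eq_zero.1 h0 with h0 | h0
      · exact h0 ▸ measureReal_mono Set.inter_subset_left
      · exact h0 ▸ measureReal_mono Set.inter_subset_right
    simp [h0, this]
  have hpos : 0 < P.real Γ * P.real Δ :=
    lt_of_le_of_ne (mul_nonneg measureReal_nonneg measureReal_nonneg) (Ne.symm h0)
  have h1 : ENNReal.ofReal |P.real (Γ ∩ Δ) / (P.real Γ * P.real Δ) - 1| ≤ psiCoeff P (k + 1) := by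
    refine le_iSup_of_le m (le_iSup_of_le Γ (le_iSup_of_le Δ (le_iSup_of_le hΓ
      (le_iSup_of_le ?_ (le_iSup_of_le h0 le_rfl)))))
    exact future_anti (by push_cast; omega) _ hΔ
  have h2 := (ENNReal.ofReal_le_iff_le_toReal (hne k)).1 h1
  calc _ = |P.real (Γ ∩ Δ) / (P.real Γ * P.real Δ) - 1| * (P.real Γ * P.real Δ) := by
        rw [← abs_of_pos hpos, ← abs_mul, abs_of_pos hpos, sub_mul, one_mul,
          div_mul_cancel₀ _ h0]
    _ ≤ _ := by gcongr

lemma PhiMixing.inter_le {a : ℕ → ℝ} (h : PhiMixing P a) {m m' : ℤ} {k : ℕ} {Γ Δ : Set (ℤ → A)}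
    (hm : m + k + 1 ≤ m') (hΓ : MeasurableSet[past A m] Γ) (hΔ : MeasurableSet[future A m'] Δ) :
    P.real (Γ ∩ Δ) ≤ P.real Γ * (a k + P.real Δ) := by
  have := (abs_le.1 (h m m' k Γ Δ hm hΓ hΔ)).2
  linarith

/-- Without a letter of probability one, cylinders have summably small probabilities. -/
lemma PhiMixing.exists_cylinder_bound [IsProbabilityMeasure P] [MeasurableSingletonClass A]
    {a : ℕ → ℝ}
    (h : PhiMixing P a) (ha : Tendsto a atTop (𝓝 0))
    (hT : MeasurePreserving (leftShift (A := A)) P P)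
    (hne : ∀ x : A, P.real {ω | ω 0 = x} ≠ 1) :
    ∃ f : ℕ → ℝ, (∀ k, 0 ≤ f k) ∧ f 0 = 1 ∧ Summable f ∧
      ∀ (l r : ℤ) (C : Set (ℤ → A)), IsCylinderOn l r C → ∀ k : ℕ, l + k ≤ r → P.real C ≤ f k := by
  have hmeas : ∀ x : A, MeasurableSet {ω : ℤ → A | ω 0 = x} := fun x =>
    (measurable_pi_apply 0 (measurableSet_singleton x) :
      MeasurableSet ((fun ω : ℤ → A => ω 0) ⁻¹' {x}))
  -- A bound below 1 uniform over a possibly infinite alphabet: at most one letter exceeds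
  -- probability 1/2, and that one is not almost sure.
  obtain ⟨α, hα0, hα1, hα⟩ : ∃ α : ℝ, 0 ≤ α ∧ α < 1 ∧ ∀ x : A, P.real {ω | ω 0 = x} ≤ α := by
    by_cases hx : ∃ x : A, 1 / 2 < P.real {ω | ω 0 = x}
    · obtain ⟨x, hx⟩ := hx
      refine ⟨P.real {ω | ω 0 = x}, measureReal_nonneg,
        lt_of_le_of_ne measureReal_le_one (hne x), fun y => ?_⟩
      by_cases hxy : y = x
      · rw [hxy]
      have hsub : {ω : ℤ → A | ω 0 = y} ⊆ {ω | ω 0 = x}ᶜ := fun ω (hω : ω 0 = y) (h' : ω 0 = x) =>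
        hxy (hω ▸ h')
      have := measureReal_mono (μ := P) hsub
      rw [probReal_compl_eq_one_sub (hmeas x)] at this
      linarith
    · push Not at hx
      exact ⟨1 / 2, by norm_num, by norm_num, hx⟩
  have hletter : ∀ (i : ℤ) (x : A), P.real {ω | ω i = x} ≤ α := fun i x =>
    (measureReal_letter hT i x).trans_le (hα x)
  -- With this gap a single further letter costs at most a k + α ≤ (1 + α) / 2 = ρ < 1, whatever the
  -- past.
  obtain ⟨k, hk⟩ : ∃ k, a k ≤ (1 - α) / 2 :=
    (ha.eventually_le_const (by linarith : (0 : ℝ) < (1 - α) / 2)).exists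
  set ρ : ℝ := (1 + α) / 2 with hρ
  have hρ0 : 0 < ρ := by linarith
  have hρ1 : ρ < 1 := by linarith
  have key : ∀ (j : ℕ) (l r : ℤ) (C : Set (ℤ → A)), IsCylinderOn l r C →
      l + (j * (k + 1) : ℕ) ≤ r → P.real C ≤ ρ ^ j := by
    intro j
    induction j with
    | zero => intro l r C _ _; simp
    | succ j ih =>
      intro l r C hC hlr
      have hexp : (((j + 1) * (k + 1) : ℕ) : ℤ) = (j * (k + 1) : ℕ) + (k + 1) := by push_cast; ring
      rw [hexp] at hlr
      have hj0 : (0 : ℤ) ≤ (j * (k + 1) : ℕ) := by positivity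
      -- Only the last letter and the coordinates at least k + 1 before it are kept, so each k + 1
      -- coordinates contribute a factor ρ.
      obtain ⟨C₁, hC₁, hcyl₁⟩ := hC.exists_superset (l' := l) (r' := r - (k + 1)) le_rfl (by omega)
      obtain ⟨C₂, hC₂, hcyl₂⟩ := hC.exists_superset (l' := r) (r' := r) (by omega) le_rfl
      have h2 : P.real C₂ ≤ α := by
        obtain ⟨b, rfl⟩ := hcyl₂
        have : {ω : ℤ → A | ∀ i, r ≤ i → i ≤ r → ω i = b i} ⊆ {ω | ω r = b r} := fun ω hω =>
          hω r le_rfl le_rfl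
        exact (measureReal_mono this).trans (hletter r (b r))
      calc P.real C ≤ P.real (C₁ ∩ C₂) := measureReal_mono (Set.subset_inter hC₁ hC₂)
        _ ≤ P.real C₁ * (a k + P.real C₂) :=
          h.inter_le (m := r - (k + 1)) (m' := r) (by omega)
            (hcyl₁.measurableSet_past (by omega) le_rfl)
            (hcyl₂.measurableSet_future le_rfl le_rfl)
        _ ≤ P.real C₁ * ρ := by gcongr; linarith
        _ ≤ ρ ^ j * ρ := by gcongr; exact ih l _ C₁ hcyl₁ (by omega)
        _ = ρ ^ (j + 1) := (pow_succ ρ j).symm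
  refine ⟨fun n => ρ ^ (n / (k + 1)), fun n => by positivity, by simp, ?_,
    fun l r C hC n hn => ?_⟩
  · refine summable_of_sum_le (c := (k + 1 : ℕ) * ∑' j, ρ ^ j) (fun n => by positivity) fun s => ?_
    refine sum_comp_le (d := fun n => n / (k + 1)) (F := fun j => ρ ^ j) (fun j => ?_)
      (fun j => by positivity) (summable_geometric_of_lt_one hρ0.le hρ1) s
    have hsub : {n : ℕ | n / (k + 1) = j} ⊆ Finset.Ico (j * (k + 1)) ((j + 1) * (k + 1)) := by
      intro n hn
      simp only [Set.mem_ofPred_eq] at hn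
      simp only [Finset.coe_Ico, Set.mem_Ico]
      rw [← hn]
      exact ⟨Nat.div_mul_le_self n _, Nat.lt_mul_of_div_lt (Nat.lt_succ_self _) (Nat.succ_pos k)⟩
    refine (Set.encard_le_encard hsub).trans ?_
    rw [Set.encard_coe_eq_coe_finsetCard, Nat.card_Ico, ← Nat.sub_mul]
    simp
  · have := Nat.div_mul_le_self n (k + 1)
    exact key _ l r C hC (by omega)

/-- The rate at which a cylinder sticking out of the past by about `s` decorrelates from it. -/
noncomputable def tailRate (a f : ℕ → ℝ) (D s : ℕ) : ℝ := a (s / 2) + f (s / 2 - (D + 1))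

lemma tailRate_nonneg {a f : ℕ → ℝ} (ha : ∀ k, 0 ≤ a k) (hf : ∀ k, 0 ≤ f k) (D s : ℕ) :
    0 ≤ tailRate a f D s := add_nonneg (ha _) (hf _)

/-- Halving the argument repeats each value twice, and truncated subtraction changes only finitely
many terms. -/
lemma summable_tailRate {a f : ℕ → ℝ} (ha0 : ∀ k, 0 ≤ a k) (hf0 : ∀ k, 0 ≤ f k)
    (ha : Summable a) (hf : Summable f) (D : ℕ) : Summable (tailRate a f D) := by
  refine (summable_comp_half ha0 ha).add
    (summable_comp_half (F := fun n => f (n - (D + 1))) (fun k => hf0 _) ?_)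
  rw [← summable_nat_add_iff (D + 1)]
  simpa using hf

/-- A cylinder reaching beyond the past `(-∞, R]` is unlikely given any event of that past. -/
lemma PhiMixing.inter_cylinder_le [IsProbabilityMeasure P]
    {a f : ℕ → ℝ} (h : PhiMixing P a) (ha : ∀ k, 0 ≤ a k)
    (hf1 : f 0 = 1)
    (hf : ∀ (l r : ℤ) (C : Set (ℤ → A)), IsCylinderOn l r C → ∀ k : ℕ, l + k ≤ r → P.real C ≤ f k)
    {R l r : ℤ} {D s : ℕ} {Γ Δ : Set (ℤ → A)} (hΓ : MeasurableSet[past A R] Γ)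
    (hΔ : IsCylinderOn l r Δ) (hr : R + s ≤ r + D) (hlr : l + (s / 2 : ℕ) ≤ r + D) :
    P.real (Γ ∩ Δ) ≤ P.real Γ * tailRate a f D s := by
  rcases lt_or_ge (s / 2) (D + 1) with hs | hs
  -- For a short overhang the truncated subtraction gives `f 0 = 1`, so the bound is trivial.
  · have h1 : 1 ≤ tailRate a f D s := by
      rw [tailRate, Nat.sub_eq_zero_of_le hs.le, hf1]
      linarith [ha (s / 2)]
    exact (measureReal_mono Set.inter_subset_left).trans
      (le_mul_of_one_le_right measureReal_nonneg h1)
  -- Dropping the coordinates up to R + s/2 opens a gap s/2; what remains of the cylinder still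
  -- extends over at least s/2 - (D + 1).
  · obtain ⟨Δ', hsub, hcyl⟩ := hΔ.exists_superset (l' := max l (R + (s / 2 : ℕ) + 1)) (r' := r)
      (le_max_left _ _) le_rfl
    calc P.real (Γ ∩ Δ) ≤ P.real (Γ ∩ Δ') := measureReal_mono (Set.inter_subset_inter_right _ hsub)
      _ ≤ P.real Γ * (a (s / 2) + P.real Δ') :=
        h.inter_le (le_max_right l _) hΓ (hcyl.measurableSet_future (by omega) le_rfl)
      _ ≤ _ := by
        rw [tailRate]
        gcongr
        exact hf _ _ _ hcyl _ (by omega)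

end Mixing

/-! ### Approximate independence of separated cylinders. -/

section Products

variable {A : Type*} [MeasurableSpace A] {P : Measure (ℤ → A)} [IsProbabilityMeasure P]
  {ι : Type*}

/-- Approximate independence of cylinders with pairwise gaps larger than `g`. -/
lemma PsiMixing.biInter_cylinder {a : ℕ → ℝ} (h : PsiMixing P a) (ha : ∀ k, 0 ≤ a k)
    {b c : ι → ℤ} {B : ι → Set (ℤ → A)} (hB : ∀ i, IsCylinderOn (b i) (c i) (B i))
    (hbc : ∀ i, b i ≤ c i) {g : ℕ}
    (hsep : ∀ i j, i ≠ j → c i + g + 1 ≤ b j ∨ c j + g + 1 ≤ b i) (s : Finset ι) :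
    P.real (⋂ i ∈ s, B i) ≤ (∏ i ∈ s, P.real (B i)) * (1 + a g) ^ s.card ∧
      (∏ i ∈ s, P.real (B i)) * (1 - s.card * a g) ≤ P.real (⋂ i ∈ s, B i) := by
  classical
  -- Cylinders are added in order of their left ends. The separation then puts all earlier ones in
  -- the past of the new one, and mixing applies once per step.
  induction s using Finset.induction_on_max_value b with
  | empty => simp
  | insert i s his hmax ih =>
    obtain ⟨ih1, ih2⟩ := ih
    have hpast : MeasurableSet[past A (b i - g - 1)] (⋂ j ∈ s, B j) := by
      refine Finset.measurableSet_biInter s fun j hj => ?_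
      have hne : j ≠ i := fun h => his (h ▸ hj)
      refine (hB j).measurableSet_past (hbc j) ?_
      have h1 := hmax j hj
      have h2 := hbc i
      have h3 := hsep j i hne
      omega
    have hfut := (hB i).measurableSet_future (m := b i) (hbc i) le_rfl
    have hψ := abs_le.1 (h (b i - g - 1) (b i) g _ _ (by omega) hpast hfut)
    set x := P.real (⋂ j ∈ s, B j) with hx
    set π := ∏ j ∈ s, P.real (B j) with hπ
    set y := P.real (B i) with hy
    have hy0 : 0 ≤ y := measureReal_nonneg
    have hx0 : 0 ≤ x := measureReal_nonneg
    have hπ0 : 0 ≤ π := Finset.prod_nonneg fun _ _ => measureReal_nonneg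
    have hag := ha g
    rw [Finset.prod_insert his, Finset.card_insert_of_notMem his, Finset.set_biInter_insert,
      Set.inter_comm]
    constructor
    · calc _ ≤ (x * y) * (1 + a g) := by linarith [hψ.2]
        _ ≤ ((π * (1 + a g) ^ s.card) * y) * (1 + a g) := by gcongr
        _ = _ := by rw [pow_succ]; ring
    · have hlow : (x * y) * (1 - a g) ≤ P.real ((⋂ j ∈ s, B j) ∩ B i) := by linarith [hψ.1]
      push_cast
      -- For a g ≤ 1 this is Bernoulli's inequality; otherwise the claimed lower bound is not
      -- positive.
      rcases le_total (a g) 1 with h1 | h1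
      · refine le_trans ?_ hlow
        calc y * π * (1 - (s.card + 1) * a g)
            ≤ y * π * ((1 - s.card * a g) * (1 - a g)) := by
              gcongr
              have : 0 ≤ s.card * a g * a g := by positivity
              linarith
          _ = ((π * (1 - s.card * a g)) * y) * (1 - a g) := by ring
          _ ≤ _ := by
              have : 0 ≤ 1 - a g := by linarith
              gcongr
      · refine le_trans ?_ measureReal_nonneg
        refine mul_nonpos_of_nonneg_of_nonpos (by positivity) ?_
        have : 0 ≤ s.card * a g := by positivity
        linarith

/-- Linearises the product error: the result is proportional to x, so it can be summed over times.
-/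
lemma one_add_pow_le {x M : ℝ} (hx : 0 ≤ x) (hM : x ≤ M) (n : ℕ) :
    (1 + x) ^ n ≤ 1 + n * (1 + M) ^ n * x := by
  induction n with
  | zero => simp
  | succ n ih =>
    have h1 : (1 + x) ^ n ≤ (1 + M) ^ n := by gcongr
    have h2 : (1 + M) ^ n ≤ (1 + M) ^ (n + 1) := by
      gcongr
      · linarith
      · omega
    calc (1 + x) ^ (n + 1) = (1 + x) ^ n + (1 + x) ^ n * x := by ring
      _ ≤ (1 + n * (1 + M) ^ n * x) + (1 + M) ^ n * x := by gcongr
      _ ≤ (1 + n * (1 + M) ^ (n + 1) * x) + (1 + M) ^ (n + 1) * x := by gcongr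
      _ = _ := by push_cast; ring

/-- Approximate independence of cylinders with pairwise gaps, in terms of the sizes of all
the gaps. -/
lemma PsiMixing.iInter_cylinder [Fintype ι] [DecidableEq ι] [Nontrivial ι] {a : ℕ → ℝ}
    (h : PsiMixing P a) (ha : ∀ k, 0 ≤ a k) (haa : Antitone a) {b c : ι → ℤ}
    {B : ι → Set (ℤ → A)} (hB : ∀ i, IsCylinderOn (b i) (c i) (B i)) (hbc : ∀ i, b i ≤ c i)
    {e : ι → ι → ℕ}
    (hsep : ∀ i j, i ≠ j → c i + e i j + 1 ≤ b j ∨ c j + e i j + 1 ≤ b i) :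
    P.real (⋂ i, B i) ≤ (∏ i, P.real (B i)) * (1 + Fintype.card ι * (1 + a 0) ^ Fintype.card ι *
        ∑ i, ∑ j, if i = j then 0 else a (e i j)) ∧
      (∏ i, P.real (B i)) * (1 - Fintype.card ι * ∑ i, ∑ j, if i = j then 0 else a (e i j)) ≤
        P.real (⋂ i, B i) := by
  have hne : (Finset.univ : Finset ι).offDiag.Nonempty := by
    obtain ⟨i, j, hij⟩ := exists_pair_ne ι
    exact ⟨(i, j), by simpa using hij⟩
  -- The smallest gap serves as the common gap. Its rate is one term of the sum over all pairs, and
  -- unlike the rate at a minimum that sum can be estimated pair by pair.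
  obtain ⟨⟨i₀, j₀⟩, h0, hmin⟩ := Finset.exists_min_image _ (fun x : ι × ι => e x.1 x.2) hne
  simp only [Finset.mem_offDiag, Finset.mem_univ, true_and, Prod.forall] at h0 hmin
  have hkey := h.biInter_cylinder ha hB hbc (g := e i₀ j₀) (fun i j hij => by
    have h1 := hmin i j hij
    rcases hsep i j hij with h2 | h2
    · left; omega
    · right; omega) Finset.univ
  have hterm : ∀ i j, 0 ≤ if i = j then 0 else a (e i j) := fun i j => by
    split_ifs
    exacts [le_rfl, ha _]
  have hle : a (e i₀ j₀) ≤ ∑ i, ∑ j, if i = j then 0 else a (e i j) := by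
    calc a (e i₀ j₀) = if i₀ = j₀ then 0 else a (e i₀ j₀) := by rw [if_neg h0]
      _ ≤ ∑ j, if i₀ = j then 0 else a (e i₀ j) :=
        Finset.single_le_sum (f := fun j => if i₀ = j then 0 else a (e i₀ j))
          (fun j _ => hterm i₀ j) (Finset.mem_univ j₀)
      _ ≤ _ := Finset.single_le_sum (f := fun i => ∑ j, if i = j then 0 else a (e i j))
          (fun i _ => Finset.sum_nonneg fun j _ => hterm i j) (Finset.mem_univ i₀)
  simp only [Finset.mem_univ, Set.iInter_true, Finset.card_univ] at hkey
  have hπ0 : 0 ≤ ∏ i, P.real (B i) := Finset.prod_nonneg fun _ _ => measureReal_nonneg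
  have ha0 := ha 0
  refine ⟨hkey.1.trans ?_, le_trans ?_ hkey.2⟩
  · refine mul_le_mul_of_nonneg_left ?_ hπ0
    refine (one_add_pow_le (ha _) (haa (Nat.zero_le _)) _).trans ?_
    gcongr
  · gcongr

end Products

/-! ### Error rates in terms of distances between shifts. -/

section Rates

variable {ℓ : ℕ}

/-- The sum of `F` over the distances between the shifts at times `m` and `n`. -/
noncomputable def crossRate (F : ℕ → ℝ) (q : Fin ℓ → ℕ → ℕ) (m n : ℕ) : ℝ :=
  ∑ i, ∑ j, F ((q i n : ℤ) - q j m).natAbs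

/-- The sum of `F` over half the distances between different shifts at time `n`. -/
noncomputable def spreadRate (F : ℕ → ℝ) (q : Fin ℓ → ℕ → ℕ) (n : ℕ) : ℝ :=
  ∑ i, ∑ j, if i = j then 0 else F (((q i n : ℤ) - q j n).natAbs / 2)

/-- The largest shift at time `n`. -/
def topShift (q : Fin ℓ → ℕ → ℕ) (n : ℕ) : ℕ := Finset.univ.sup fun i => q i n

open Classical in
/-- The indicator of the pairs of times violating the growth of the largest shift. -/
noncomputable def excess (q : Fin ℓ → ℕ → ℕ) (m n : ℕ) : ℝ :=
  if m < n ∧ topShift q n ≤ topShift q m then 1 else 0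

lemma excess_nonneg (q : Fin ℓ → ℕ → ℕ) (m n : ℕ) : 0 ≤ excess q m n := by
  unfold excess; split_ifs <;> simp

lemma crossRate_nonneg {F : ℕ → ℝ} (hF : ∀ k, 0 ≤ F k) (q : Fin ℓ → ℕ → ℕ) (m n : ℕ) :
    0 ≤ crossRate F q m n :=
  Finset.sum_nonneg fun _ _ => Finset.sum_nonneg fun _ _ => hF _

lemma spreadRate_nonneg {F : ℕ → ℝ} (hF : ∀ k, 0 ≤ F k) (q : Fin ℓ → ℕ → ℕ) (n : ℕ) :
    0 ≤ spreadRate F q n :=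
  Finset.sum_nonneg fun _ _ => Finset.sum_nonneg fun _ _ => by split_ifs; exacts [le_rfl, hF _]

lemma le_crossRate {F : ℕ → ℝ} (hF : ∀ k, 0 ≤ F k) (q : Fin ℓ → ℕ → ℕ) (m n : ℕ)
    (i j : Fin ℓ) : F ((q i n : ℤ) - q j m).natAbs ≤ crossRate F q m n :=
  calc F ((q i n : ℤ) - q j m).natAbs ≤ ∑ j, F ((q i n : ℤ) - q j m).natAbs :=
        Finset.single_le_sum (f := fun j => F ((q i n : ℤ) - q j m).natAbs) (fun _ _ => hF _)
          (Finset.mem_univ j)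
    _ ≤ _ := Finset.single_le_sum (f := fun i => ∑ j, F ((q i n : ℤ) - q j m).natAbs)
          (fun _ _ => Finset.sum_nonneg fun _ _ => hF _) (Finset.mem_univ i)

lemma le_spreadRate {F : ℕ → ℝ} (hF : ∀ k, 0 ≤ F k) (q : Fin ℓ → ℕ → ℕ) (n : ℕ)
    {i j : Fin ℓ} (hij : i ≠ j) : F (((q i n : ℤ) - q j n).natAbs / 2) ≤ spreadRate F q n := by
  have hterm : ∀ i j, 0 ≤ if i = j then 0 else F (((q i n : ℤ) - q j n).natAbs / 2) :=
    fun i j => by split_ifs; exacts [le_rfl, hF _]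
  calc F (((q i n : ℤ) - q j n).natAbs / 2)
      = if i = j then 0 else F (((q i n : ℤ) - q j n).natAbs / 2) := (if_neg hij).symm
    _ ≤ ∑ j, if i = j then 0 else F (((q i n : ℤ) - q j n).natAbs / 2) :=
        Finset.single_le_sum (f := fun j => if i = j then 0 else
          F (((q i n : ℤ) - q j n).natAbs / 2)) (fun j _ => hterm i j) (Finset.mem_univ j)
    _ ≤ _ := Finset.single_le_sum (f := fun i => ∑ j, if i = j then 0 else
          F (((q i n : ℤ) - q j n).natAbs / 2))
          (fun i _ => Finset.sum_nonneg fun j _ => hterm i j) (Finset.mem_univ i)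

/-- With m fixed, |q_i(n) - q_j(m)| = k forces one of two values of q_i(n), each taken at most K
times; hence the bound is uniform in m. -/
lemma sum_crossRate_le {F : ℕ → ℝ} (hF0 : ∀ k, 0 ≤ F k) (hF : Summable F)
    {q : Fin ℓ → ℕ → ℕ} {K : ℕ} (hq : ∀ (i : Fin ℓ) (k : ℤ), {n | (q i n : ℤ) = k}.encard ≤ K)
    (m : ℕ) (s : Finset ℕ) :
    ∑ n ∈ s, crossRate F q m n ≤ ℓ * (ℓ * ((2 * K : ℕ) * ∑' k, F k)) := by
  unfold crossRate
  rw [Finset.sum_comm]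
  simp_rw [Finset.sum_comm (s := s)]
  calc _ ≤ ∑ _i : Fin ℓ, ∑ _j : Fin ℓ, ((2 * K : ℕ) * ∑' k, F k) := by
        refine Finset.sum_le_sum fun i _ => Finset.sum_le_sum fun j _ => ?_
        refine sum_comp_le (d := fun n => ((q i n : ℤ) - q j m).natAbs)
          (encard_natAbs_fiber_le fun k => ?_) hF0 hF s
        simp_rw [sub_eq_iff_eq_add]
        exact hq i _
    _ = _ := by simp

/-- Here the count of solutions of q_i(n) - q_j(n) = k enters. -/
lemma summable_spread {F : ℕ → ℝ} (hF0 : ∀ k, 0 ≤ F k) (hF : Summable F) {q : Fin ℓ → ℕ → ℕ}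
    {K : ℕ} (hq : ∀ i j : Fin ℓ, i ≠ j → ∀ k : ℤ,
      {n : ℕ | (q i n : ℤ) - (q j n : ℤ) = k ∨ (q i n : ℤ) = k}.encard ≤ K) :
    Summable (spreadRate F q) := by
  refine summable_sum fun i _ => summable_sum fun j _ => ?_
  split_ifs with hij
  · exact summable_zero
  refine summable_of_sum_le (c := (2 * K : ℕ) * ∑' k, F (k / 2)) (fun n => hF0 _) fun s => ?_
  exact sum_comp_le (d := fun n => ((q i n : ℤ) - q j n).natAbs) (F := fun k => F (k / 2))
    (encard_natAbs_fiber_le fun k => (Set.encard_le_encard fun n hn => Or.inl hn).trans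
      (hq i j hij k)) (fun k => hF0 _) (summable_comp_half hF0 hF) s

lemma sum_excess_le {q : Fin ℓ → ℕ → ℕ} {K : ℕ} (hq : {p : ℕ × ℕ | p.1 < p.2 ∧
      (Finset.univ.sup fun i => q i p.2) ≤ Finset.univ.sup fun i => q i p.1}.encard ≤ K)
    (m : ℕ) (s : Finset ℕ) : ∑ n ∈ s, excess q m n ≤ K := by
  classical
  unfold excess
  rw [Finset.sum_ite, Finset.sum_const_zero, add_zero, Finset.sum_const, nsmul_eq_mul, mul_one]
  have hinj : Function.Injective fun n : ℕ => (m, n) := fun _ _ h => (Prod.mk.inj h).2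
  have h1 : ((s.filter fun n => m < n ∧ topShift q n ≤ topShift q m : Finset ℕ) :
      Set ℕ).encard ≤ K := by
    rw [← hinj.encard_image]
    refine (Set.encard_le_encard ?_).trans hq
    rintro _ ⟨n, hn, rfl⟩
    exact (Finset.mem_filter.1 hn).2
  rw [Set.encard_coe_eq_coe_finsetCard] at h1
  exact_mod_cast h1

end Rates

/-! ### Hit events, and pairs of times with close shifts. -/

section Hits

variable {A : Type*} {ℓ : ℕ}

/-- The event `⋂ i, T^{-q_i(n)} C_n^{(i)}`. -/
def hitEvent (q : Fin ℓ → ℕ → ℕ) (C : ℕ → Fin ℓ → Set (ℤ → A)) (n : ℕ) : Set (ℤ → A) :=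
  ⋂ i, leftShift^[q i n] ⁻¹' C n i

lemma hitSum_eq_occSum (q : Fin ℓ → ℕ → ℕ) (C : ℕ → Fin ℓ → Set (ℤ → A)) (N : ℕ) (ω : ℤ → A) :
    hitSum q C N ω = occSum (hitEvent q C) N ω := by
  refine Finset.sum_congr rfl fun n _ => ?_
  by_cases h : ω ∈ hitEvent q C n
  · rw [Set.indicator_of_mem h]
    refine Finset.prod_eq_one fun i _ => Set.indicator_of_mem ?_ _
    exact Set.mem_iInter.1 h i
  · rw [Set.indicator_of_notMem h]
    obtain ⟨i, hi⟩ := not_forall.1 fun h' => h (Set.mem_iInter.2 h')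
    have hi' : leftShift^[q i n] ω ∉ C n i := hi
    exact Finset.prod_eq_zero (Finset.mem_univ i) (Set.indicator_of_notMem hi' _)

variable {q : Fin ℓ → ℕ → ℕ} {C : ℕ → Fin ℓ → Set (ℤ → A)} {l r : ℕ → ℤ}

lemma measurableSet_past_hitEvent (hC : ∀ n i, IsCylinderOn (l n) (r n) (C n i))
    (hlr : ∀ n, l n ≤ r n) (n : ℕ) :
    MeasurableSet[past A (r n + topShift q n)] (hitEvent q C n) := by
  refine MeasurableSet.iInter fun i => ((hC n i).preimage_iterate _).measurableSet_past
    (by linarith [hlr n]) ?_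
  have : q i n ≤ topShift q n := Finset.le_sup (f := fun i => q i n) (Finset.mem_univ i)
  omega

variable [MeasurableSpace A] {P : Measure (ℤ → A)}
  [IsProbabilityMeasure P]

lemma measurableSet_hitEvent [MeasurableSingletonClass A]
    (hC : ∀ n i, IsCylinderOn (l n) (r n) (C n i)) (n : ℕ) :
    MeasurableSet (hitEvent q C n) :=
  MeasurableSet.iInter fun i => ((hC n i).preimage_iterate _).measurableSet

/-- If at some pair of indices the times `m` and `n` are close, the block with the largest shift
at time `n` still sticks out to the right of all blocks at time `m`. -/
lemma PhiMixing.hitEvent_inter_le_of_close {a f : ℕ → ℝ} (h : PhiMixing P a) (ha : ∀ k, 0 ≤ a k)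
    (hf0 : ∀ k, 0 ≤ f k) (hf1 : f 0 = 1)
    (hf : ∀ (l r : ℤ) (C : Set (ℤ → A)), IsCylinderOn l r C → ∀ k : ℕ, l + k ≤ r → P.real C ≤ f k)
    (hC : ∀ n i, IsCylinderOn (l n) (r n) (C n i)) (hlr : ∀ n, l n ≤ r n) {D m n : ℕ}
    (hr : r m ≤ r n + D) (hmn : topShift q m < topShift q n) (i j : Fin ℓ)
    (hij : ((((q i n : ℤ) - q j m).natAbs / 2 : ℕ) : ℤ) ≤ r n - l n + D) :
    P.real (hitEvent q C m ∩ hitEvent q C n) ≤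
      P.real (hitEvent q C m) * crossRate (tailRate a f D) q m n := by
  have hne : (Finset.univ : Finset (Fin ℓ)).Nonempty := ⟨i, Finset.mem_univ i⟩
  obtain ⟨i₁, -, hi₁⟩ := Finset.exists_mem_eq_sup _ hne fun i => q i n
  obtain ⟨j₁, -, hj₁⟩ := Finset.exists_mem_eq_sup _ hne fun i => q i m
  change topShift q n = q i₁ n at hi₁
  change topShift q m = q j₁ m at hj₁
  -- Only the block with the largest shift at time n is kept. Right nestedness makes it exceed the
  -- past containing the whole event at time m by at least s - D.
  have key : ∀ s : ℕ, s ≤ topShift q n - topShift q m → ((s / 2 : ℕ) : ℤ) ≤ r n - l n + D →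
      P.real (hitEvent q C m ∩ hitEvent q C n) ≤
        P.real (hitEvent q C m) * tailRate a f D s := by
    intro s hs hs'
    calc P.real (hitEvent q C m ∩ hitEvent q C n)
        ≤ P.real (hitEvent q C m ∩ leftShift^[q i₁ n] ⁻¹' C n i₁) :=
          measureReal_mono (Set.inter_subset_inter_right _ (Set.iInter_subset _ i₁))
      _ ≤ _ := h.inter_cylinder_le ha hf1 hf (measurableSet_past_hitEvent hC hlr m)
          ((hC n i₁).preimage_iterate _) (by omega) (by omega)
  have hF0 := tailRate_nonneg ha hf0 D
  -- The overhang used is the smaller of the close distance and the difference of the largest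
  -- shifts. Both are distances between a shift at n and one at m, so the cross rate covers either.
  rcases le_total ((q i n : ℤ) - q j m).natAbs (topShift q n - topShift q m) with hle | hle
  · refine (key _ hle hij).trans (mul_le_mul_of_nonneg_left ?_ measureReal_nonneg)
    exact le_crossRate hF0 q m n i j
  · refine (key _ le_rfl (by omega)).trans (mul_le_mul_of_nonneg_left ?_ measureReal_nonneg)
    have : topShift q n - topShift q m = ((q i₁ n : ℤ) - q j₁ m).natAbs := by omega
    rw [this]
    exact le_crossRate hF0 q m n i₁ j₁

end Hits

/-! ### Discarding times of summable probability. -/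

section Restriction

variable {Ω : Type*} [MeasurableSpace Ω] {P : Measure Ω}

lemma tendsto_div_zero_of_bounded {b E : ℕ → ℝ} {B : ℝ} (h0 : ∀ n, 0 ≤ b n) (hB : ∀ n, b n ≤ B)
    (hE : Tendsto E atTop atTop) : Tendsto (fun n => b n / E n) atTop (𝓝 0) := by
  refine tendsto_of_tendsto_of_tendsto_of_le_of_le' tendsto_const_nhds
    (hE.const_div_atTop B) ?_ ?_
  · filter_upwards [hE.eventually_gt_atTop 0] with n hn using div_nonneg (h0 n) hn.le
  · filter_upwards [hE.eventually_gt_atTop 0] with n hn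
    gcongr
    exact hB n

open Classical in
/-- Times with summable probabilities may be discarded. -/
lemma ae_tendsto_occSum_div_of_restrict [IsFiniteMeasure P] {U : ℕ → Set Ω}
    (hU : ∀ n, MeasurableSet (U n)) {p : ℕ → ℝ} (hp0 : ∀ n, 0 ≤ p n)
    (hE : Tendsto (fun N => ∑ n ∈ Finset.Icc 1 N, p n) atTop atTop) (G : Set ℕ)
    (hbad : Summable fun n => if n ∈ G then 0 else p n)
    (hbadU : Summable fun n => if n ∈ G then 0 else P.real (U n))
    (h : Tendsto (fun N => ∑ n ∈ Finset.Icc 1 N, if n ∈ G then p n else 0) atTop atTop →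
      ∀ᵐ ω ∂P, Tendsto (fun N => occSum (fun n => if n ∈ G then U n else ∅) N ω /
        ∑ n ∈ Finset.Icc 1 N, if n ∈ G then p n else 0) atTop (𝓝 1)) :
    ∀ᵐ ω ∂P, Tendsto (fun N => occSum U N ω / ∑ n ∈ Finset.Icc 1 N, p n) atTop (𝓝 1) := by
  set E : ℕ → ℝ := fun N => ∑ n ∈ Finset.Icc 1 N, p n with hEdef
  set E' : ℕ → ℝ := fun N => ∑ n ∈ Finset.Icc 1 N, if n ∈ G then p n else 0 with hE'def
  set b : ℕ → ℝ := fun N => ∑ n ∈ Finset.Icc 1 N, if n ∈ G then 0 else p n with hbdef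
  have hb0' : ∀ n, 0 ≤ if n ∈ G then 0 else p n := fun n => by
    split_ifs
    exacts [le_rfl, hp0 n]
  have hb0 : ∀ N, 0 ≤ b N := fun N => Finset.sum_nonneg fun n _ => hb0' n
  have hbB : ∀ N, b N ≤ ∑' n, if n ∈ G then 0 else p n := fun N =>
    hbad.sum_le_tsum _ fun n _ => hb0' n
  have hsplit : ∀ N, E N = E' N + b N := fun N => by
    simp only [hEdef, hE'def, hbdef, ← Finset.sum_add_distrib]
    refine Finset.sum_congr rfl fun n _ => ?_
    split_ifs <;> simp
  have hE't : Tendsto E' atTop atTop := by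
    refine tendsto_atTop_mono (fun N => ?_)
      (tendsto_atTop_add_const_right _ (-∑' n, if n ∈ G then 0 else p n) hE)
    have h1 := hsplit N
    have h2 := hbB N
    change E N + _ ≤ E' N
    linarith
  have hEE : Tendsto (fun N => E' N / E N) atTop (𝓝 1) := by
    have h1 := (tendsto_div_zero_of_bounded hb0 hbB hE).const_sub 1
    rw [sub_zero] at h1
    refine h1.congr' ?_
    filter_upwards [hE.eventually_gt_atTop 0] with N hN
    have h2 : E' N = E N - b N := by rw [hsplit]; ring
    change 1 - b N / E N = E' N / E N
    have hN' : E N ≠ 0 := ne_of_gt hN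
    rw [h2, sub_div, div_self hN']
  -- Borel–Cantelli: almost surely the discarded events contribute a bounded amount, negligible
  -- against E_N.
  have hY : ∀ᵐ ω ∂P, Summable fun n =>
      (if n ∈ G then ∅ else U n : Set Ω).indicator (fun _ => (1 : ℝ)) ω := by
    have hm : ∀ n, MeasurableSet (if n ∈ G then ∅ else U n : Set Ω) := fun n => by
      split_ifs
      exacts [MeasurableSet.empty, hU n]
    refine ae_summable_of_summable_integral (fun n => (integrable_const 1).indicator (hm n))
      (fun n ω => Set.indicator_nonneg (fun _ _ => zero_le_one) ω) (hbadU.congr fun n => ?_)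
    rw [integral_indicator_const _ (hm n)]
    split_ifs <;> simp
  filter_upwards [h hE't, hY] with ω h1 h2
  have hR := tendsto_div_zero_of_bounded (b := fun N => occSum (fun n => if n ∈ G then ∅ else U n) N ω)
    (fun N => occSum_nonneg _ N ω)
    (fun N => h2.sum_le_tsum (Finset.Icc 1 N)
      fun n _ => Set.indicator_nonneg (fun _ _ => zero_le_one) ω) hE
  have h3 := (h1.mul hEE).add hR
  rw [mul_one, add_zero] at h3
  refine h3.congr' ?_
  filter_upwards [hE.eventually_gt_atTop 0, hE't.eventually_gt_atTop 0] with N hN hN'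
  have hS : occSum U N ω = occSum (fun n => if n ∈ G then U n else ∅) N ω +
      occSum (fun n => if n ∈ G then ∅ else U n) N ω := by
    simp only [occSum, ← Finset.sum_add_distrib]
    refine Finset.sum_congr rfl fun n _ => ?_
    split_ifs <;> simp
  have hN1 : E N ≠ 0 := ne_of_gt hN
  change _ / E' N * (E' N / E N) + _ / E N = _ / E N
  rw [div_mul_div_cancel₀ hN'.ne', hS, add_div]

end Restriction

/-! ### The constant process and the case of one shift. -/

section Shift

variable {A : Type*} [MeasurableSpace A] [MeasurableSingletonClass A] {P : Measure (ℤ → A)}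
  [IsProbabilityMeasure P] {ℓ : ℕ} {q : Fin ℓ → ℕ → ℕ} {C : ℕ → Fin ℓ → Set (ℤ → A)} {l r : ℕ → ℤ}

/-- If some letter has probability one, the process is constant and both sums agree. -/
lemma ae_tendsto_of_letter (hT : MeasurePreserving (leftShift (A := A)) P P)
    (hE : Tendsto (probSum P C) atTop atTop) {x : A} (hx : P.real {ω | ω 0 = x} = 1) :
    ∀ᵐ ω ∂P, Tendsto (fun N => hitSum q C N ω / probSum P C N) atTop (𝓝 1) := by
  have hconst : ∀ᵐ ω ∂P, ω = fun _ => x := by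
    have : ∀ᵐ ω ∂P, ∀ i : ℤ, ω i = x := by
      refine ae_all_iff.2 fun i => ?_
      have h1 : P.real {ω : ℤ → A | ω i = x} = 1 := (measureReal_letter hT i x).trans hx
      have h2 : P {ω : ℤ → A | ω i = x} = 1 := by
        rw [measureReal_def] at h1
        exact (ENNReal.toReal_eq_one_iff _).1 h1
      exact (prob_compl_eq_zero_iff (isCylinderOn_letter i x).measurableSet).2 h2
    filter_upwards [this] with ω hω using funext hω
  have hP : ∀ S : Set (ℤ → A), P.real S = S.indicator (fun _ => (1 : ℝ)) fun _ => x := by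
    intro S
    by_cases hS : (fun _ => x) ∈ S
    · rw [Set.indicator_of_mem hS, measureReal_def,
        measure_congr (eventuallyEq_univ.2
          (by filter_upwards [hconst] with ω hω; rw [hω]; exact hS)), measure_univ]
      rfl
    · rw [Set.indicator_of_notMem hS, measureReal_def,
        measure_eq_zero_iff_ae_notMem.2 (by filter_upwards [hconst] with ω hω; rw [hω]; exact hS)]
      rfl
  filter_upwards [hconst] with ω hω
  have heq : ∀ N, hitSum q C N ω = probSum P C N := by
    intro N
    refine Finset.sum_congr rfl fun n _ => Finset.prod_congr rfl fun i _ => ?_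
    have : leftShift^[q i n] ω = fun _ => x := by
      ext j
      rw [leftShift_iterate, hω]
    rw [this, hP]
  refine tendsto_const_nhds.congr' ?_
  filter_upwards [hE.eventually_gt_atTop 0] with N hN
  rw [heq, div_self hN.ne']

/-- The case of a single shift and summable `φ`. -/
theorem ae_tendsto_of_phiSummable (hT : MeasurePreserving (leftShift (A := A)) P P)
    {q : Fin 1 → ℕ → ℕ} {C : ℕ → Fin 1 → Set (ℤ → A)} (hq : GrowthAssumption q)
    (hlr : ∀ n, l n ≤ r n) (hC : ∀ n i, IsCylinderOn (l n) (r n) (C n i))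
    (hE : Tendsto (probSum P C) atTop atTop) (hP : PhiSummable P) {D : ℕ}
    (hnest : ∀ m n, m < n → r m ≤ r n + D) :
    ∀ᵐ ω ∂P, Tendsto (fun N => hitSum q C N ω / probSum P C N) atTop (𝓝 1) := by
  by_cases hx : ∃ x : A, P.real {ω | ω 0 = x} = 1
  · exact hx.elim fun x hx => ae_tendsto_of_letter hT hE hx
  push Not at hx
  obtain ⟨K, -, -, hfib, hpairs⟩ := hq
  obtain ⟨a, ha0, has, hφ⟩ := hP.exists_phiMixing
  obtain ⟨f, hf0, hf1, hfs, hf⟩ :=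
    hφ.exists_cylinder_bound has.tendsto_atTop_zero hT hx
  set F := tailRate a f D with hF
  have hF0 : ∀ k, 0 ≤ F k := tailRate_nonneg ha0 hf0 D
  have hFs : Summable F := summable_tailRate ha0 hf0 has hfs D
  have hUm := measurableSet_hitEvent (q := q) hC
  have hsingle : ∀ n, hitEvent q C n = leftShift^[q 0 n] ⁻¹' C n 0 := fun n => by
    ext ω
    simp [hitEvent]
  have hprob : ∀ n, P.real (hitEvent q C n) = P.real (C n 0) := fun n => by
    rw [hsingle]
    exact (hC n 0).measureReal_preimage hT _
  have hpair : ∀ m n, m < n → P.real (hitEvent q C m ∩ hitEvent q C n) ≤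
      P.real (C m 0) * P.real (C n 0) * (1 + 0 + 0) +
        P.real (C m 0) * (crossRate F q m n + excess q m n) := by
    intro m n hmn
    have hm0 : 0 ≤ P.real (C m 0) := measureReal_nonneg
    have hmn0 : 0 ≤ P.real (C m 0) * P.real (C n 0) := mul_nonneg hm0 measureReal_nonneg
    have hcr := crossRate_nonneg hF0 q m n
    have hex := excess_nonneg q m n
    have htop : ∀ k, topShift q k = q 0 k := fun k => by simp [topShift]
    by_cases htop' : topShift q n ≤ topShift q m
    · have h1 : excess q m n = 1 := if_pos ⟨hmn, htop'⟩
      have h2 : P.real (hitEvent q C m ∩ hitEvent q C n) ≤ P.real (C m 0) :=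
        (measureReal_mono Set.inter_subset_left).trans_eq (hprob m)
      have h3 := mul_nonneg hm0 hcr
      rw [h1]
      linarith
    push Not at htop'
    have hr := hnest m n hmn
    have h3 := mul_nonneg hm0 hex
    by_cases hclose : ((((q 0 n : ℤ) - q 0 m).natAbs / 2 : ℕ) : ℤ) ≤ r n - l n + D
    · have h1 := hφ.hitEvent_inter_le_of_close ha0 hf0 hf1 hf hC hlr hr htop' 0 0 hclose
      rw [hprob] at h1
      linarith
    -- The distance exceeds twice the window length plus D, so half of it remains as a gap. Time m
    -- lies to the left, so right nestedness suffices and the φ-error carries the weight P(C_m).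
    · have hq0 : q 0 m < q 0 n := by rwa [htop, htop] at htop'
      have h1 := hφ.inter_le (m := r m + topShift q m) (m' := l n + q 0 n)
        (k := ((q 0 n : ℤ) - q 0 m).natAbs / 2) (Γ := hitEvent q C m)
        (Δ := leftShift^[q 0 n] ⁻¹' C n 0) (by rw [htop]; omega)
        (measurableSet_past_hitEvent hC hlr m)
        (((hC n 0).preimage_iterate _).measurableSet_future (by linarith [hlr n]) le_rfl)
      rw [← hsingle, hprob, hprob] at h1
      have h4 : a (((q 0 n : ℤ) - q 0 m).natAbs / 2) ≤ crossRate F q m n :=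
        (le_add_of_nonneg_right (hf0 _)).trans (le_crossRate hF0 q m n 0 0)
      have h5 := mul_le_mul_of_nonneg_left h4 hm0
      linarith
  set c : ℝ := ((1 : ℕ) : ℝ) * (((1 : ℕ) : ℝ) * ((2 * K : ℕ) * ∑' k, F k)) + K with hc
  have hc0 : 0 ≤ c := by
    have : 0 ≤ ∑' k, F k := tsum_nonneg hF0
    positivity
  have hvar := integral_occSum_sub_sq_le (P := P) hUm (p := fun n => P.real (C n 0))
    (η := fun _ => 0) (θ := fun m n => crossRate F q m n + excess q m n) (C := 1 + c)
    (fun n => measureReal_nonneg) (fun n => measureReal_le_one) (fun n => le_rfl)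
    (fun m n => add_nonneg (crossRate_nonneg hF0 q m n) (excess_nonneg q m n))
    (fun n => by
      rw [hprob]
      exact le_mul_of_one_le_left measureReal_nonneg (by linarith))
    (fun n => by rw [hprob]; simp) hpair
    (fun N => by simp only [Finset.sum_const_zero]; linarith)
    (fun m N => by
      rw [Finset.sum_add_distrib]
      have h1 := sum_crossRate_le hF0 hFs hfib m (Finset.Icc 1 N)
      have h2 := sum_excess_le hpairs m (Finset.Icc 1 N)
      linarith)
  have hprobSum : probSum P C = fun N => ∑ n ∈ Finset.Icc 1 N, P.real (C n 0) := by
    ext N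
    simp [probSum]
  rw [hprobSum] at hE ⊢
  have := ae_tendsto_occSum_div hUm (fun n => measureReal_nonneg)
    (fun n => measureReal_le_one) hE hvar
  simpa only [hitSum_eq_occSum] using this

end Shift

/-- Both sums only involve the data at the times `n ≥ 1`. -/
lemma hitSum_max_one {A : Type*} {ℓ : ℕ} (q : Fin ℓ → ℕ → ℕ) (C : ℕ → Fin ℓ → Set (ℤ → A)) :
    hitSum q (fun n => C (max n 1)) = hitSum q C := by
  ext N ω
  refine Finset.sum_congr rfl fun n hn => ?_
  simp only [max_eq_left (Finset.mem_Icc.1 hn).1]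

lemma probSum_max_one {A : Type*} [MeasurableSpace A] {ℓ : ℕ}
    (P : Measure (ℤ → A)) (C : ℕ → Fin ℓ → Set (ℤ → A)) :
    probSum P (fun n => C (max n 1)) = probSum P C := by
  ext N
  refine Finset.sum_congr rfl fun n hn => ?_
  simp only [max_eq_left (Finset.mem_Icc.1 hn).1]

/-! ### The case of several shifts. -/

section Shift

variable {A : Type*} [MeasurableSpace A] [MeasurableSingletonClass A] {P : Measure (ℤ → A)}
  [IsProbabilityMeasure P] {ℓ : ℕ} {q : Fin ℓ → ℕ → ℕ} {C : ℕ → Fin ℓ → Set (ℤ → A)} {l r : ℕ → ℤ}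

/-- The times at which the shifts of the window `[l n, r n]` are well separated. -/
def separatedTimes (q : Fin ℓ → ℕ → ℕ) (l r : ℕ → ℤ) : Set ℕ :=
  {n | ∀ i j : Fin ℓ, i ≠ j →
    r n - l n < ((((q i n : ℤ) - q j n).natAbs / 2 : ℕ) : ℤ)}

/-- At separated times the hitting probability is comparable to the product of probabilities. -/
lemma PsiMixing.hitEvent_bounds (hT : MeasurePreserving (leftShift (A := A)) P P) (hℓ : 1 < ℓ)
    {a : ℕ → ℝ} (h : PsiMixing P a) (ha : ∀ k, 0 ≤ a k) (haa : Antitone a)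
    (hlr : ∀ n, l n ≤ r n) (hC : ∀ n i, IsCylinderOn (l n) (r n) (C n i)) {n : ℕ}
    (hn : n ∈ separatedTimes q l r) :
    P.real (hitEvent q C n) ≤ (1 + a 0) ^ ℓ * ∏ i, P.real (C n i) ∧
      (∏ i, P.real (C n i)) * (1 - ℓ * spreadRate a q n) ≤ P.real (hitEvent q C n) := by
  have : Nontrivial (Fin ℓ) := Fin.nontrivial_iff_two_le.2 hℓ
  have hcyl := fun i => (hC n i).preimage_iterate (q i n)
  have hsep : ∀ i j : Fin ℓ, i ≠ j →
      r n + q i n + ((((q i n : ℤ) - q j n).natAbs / 2 : ℕ) : ℤ) + 1 ≤ l n + q j n ∨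
      r n + q j n + ((((q i n : ℤ) - q j n).natAbs / 2 : ℕ) : ℤ) + 1 ≤ l n + q i n := by
    intro i j hij
    have := hn i j hij
    omega
  have hprod : ∏ i, P.real (leftShift^[q i n] ⁻¹' C n i) = ∏ i, P.real (C n i) :=
    Finset.prod_congr rfl fun i _ => (hC n i).measureReal_preimage hT _
  have hle : ∀ i : Fin ℓ, l n + q i n ≤ r n + q i n := fun i => by linarith [hlr n]
  constructor
  · have h1 := (h.biInter_cylinder ha hcyl hle (g := 0)
      (fun i j hij => by have := hsep i j hij; omega) Finset.univ).1
    simp only [Finset.mem_univ, Set.iInter_true, Finset.card_univ, Fintype.card_fin] at h1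
    rw [hprod, mul_comm] at h1
    exact h1
  · have h2 := (h.iInter_cylinder ha haa hcyl hle
      (e := fun i j => ((q i n : ℤ) - q j n).natAbs / 2) hsep).2
    rw [hprod, Fintype.card_fin] at h2
    exact h2

/-- Approximate independence of two separated times at a distance from each other. -/
lemma PsiMixing.hitEvent_inter_le_of_far (hT : MeasurePreserving (leftShift (A := A)) P P)
    (hℓ : 1 < ℓ) {a : ℕ → ℝ} (h : PsiMixing P a) (ha : ∀ k, 0 ≤ a k) (haa : Antitone a)
    (hlr : ∀ n, l n ≤ r n) (hC : ∀ n i, IsCylinderOn (l n) (r n) (C n i)) {m n D : ℕ}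
    (hm : m ∈ separatedTimes q l r) (hn : n ∈ separatedTimes q l r)
    (hl : l n ≤ l m + D) (hr : r m ≤ r n + D)
    (hfar : ∀ i j : Fin ℓ, r n - l n + D < ((((q i n : ℤ) - q j m).natAbs / 2 : ℕ) : ℤ)) :
    P.real (hitEvent q C m ∩ hitEvent q C n) ≤
      (∏ i, P.real (C m i)) * (∏ i, P.real (C n i)) *
        (1 + (ℓ + ℓ : ℕ) * (1 + a 0) ^ (ℓ + ℓ) * (spreadRate a q m + spreadRate a q n +
          2 * crossRate (fun k => a (k / 2)) q m n)) := by
  -- The blocks of both times are treated as one family of 2ℓ cylinders, since they may interleave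
  -- in any order.
  have : Nontrivial (Fin ℓ ⊕ Fin ℓ) :=
    ⟨Sum.inl ⟨0, by omega⟩, Sum.inr ⟨0, by omega⟩, Sum.inl_ne_inr⟩
  set Q : Fin ℓ ⊕ Fin ℓ → ℕ := Sum.elim (fun i => q i n) (fun i => q i m) with hQ
  set B : Fin ℓ ⊕ Fin ℓ → Set (ℤ → A) := Sum.elim (fun i => leftShift^[q i n] ⁻¹' C n i)
    (fun i => leftShift^[q i m] ⁻¹' C m i) with hB
  set b : Fin ℓ ⊕ Fin ℓ → ℤ := Sum.elim (fun i => l n + q i n) (fun i => l m + q i m) with hb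
  set c : Fin ℓ ⊕ Fin ℓ → ℤ := Sum.elim (fun i => r n + q i n) (fun i => r m + q i m) with hc
  have hcyl : ∀ u, IsCylinderOn (b u) (c u) (B u) := by
    rintro (i | i)
    exacts [(hC n i).preimage_iterate _, (hC m i).preimage_iterate _]
  have hbc : ∀ u, b u ≤ c u := by
    rintro (i | i)
    · simp only [hb, hc, Sum.elim_inl]; linarith [hlr n]
    · simp only [hb, hc, Sum.elim_inr]; linarith [hlr m]
  -- A block of time n may lie on either side of a block of time m, so the mixed cases need
  -- nestedness at both ends.
  have hsep : ∀ u v, u ≠ v → c u + ((((Q u : ℤ) - Q v).natAbs / 2 : ℕ) : ℤ) + 1 ≤ b v ∨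
      c v + ((((Q u : ℤ) - Q v).natAbs / 2 : ℕ) : ℤ) + 1 ≤ b u := by
    rintro (i | i) (j | j) huv
    · have := hn i j fun hij => huv (congrArg _ hij)
      simp only [hb, hc, hQ, Sum.elim_inl]
      omega
    · have := hfar i j
      simp only [hb, hc, hQ, Sum.elim_inl, Sum.elim_inr]
      omega
    · have := hfar j i
      simp only [hb, hc, hQ, Sum.elim_inl, Sum.elim_inr]
      omega
    · have := hm i j fun hij => huv (congrArg _ hij)
      simp only [hb, hc, hQ, Sum.elim_inr]
      omega
  have key := (h.iInter_cylinder ha haa hcyl hbc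
    (e := fun u v => ((Q u : ℤ) - Q v).natAbs / 2) hsep).1
  have hset : ⋂ u, B u = hitEvent q C m ∩ hitEvent q C n := by
    rw [Set.iInter_sum, Set.inter_comm]
    rfl
  have hprod : ∏ u, P.real (B u) = (∏ i, P.real (C m i)) * ∏ i, P.real (C n i) := by
    rw [Fintype.prod_sum_type, mul_comm]
    congr 1
    · exact Finset.prod_congr rfl fun i _ => (hC m i).measureReal_preimage hT _
    · exact Finset.prod_congr rfl fun i _ => (hC n i).measureReal_preimage hT _
  have hsum : (∑ u, ∑ v, if u = v then 0 else a (((Q u : ℤ) - Q v).natAbs / 2)) =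
      spreadRate a q m + spreadRate a q n + 2 * crossRate (fun k => a (k / 2)) q m n := by
    have hswap : ∑ i : Fin ℓ, ∑ j : Fin ℓ, a (((q i m : ℤ) - q j n).natAbs / 2) =
        crossRate (fun k => a (k / 2)) q m n := by
      rw [Finset.sum_comm, crossRate]
      refine Finset.sum_congr rfl fun i _ => Finset.sum_congr rfl fun j _ => ?_
      congr 2
      omega
    have e1 : crossRate (fun k => a (k / 2)) q m n =
      ∑ i : Fin ℓ, ∑ j : Fin ℓ, a (((q i n : ℤ) - q j m).natAbs / 2) := rfl
    simp only [Fintype.sum_sum_type, Finset.sum_add_distrib, hQ, Sum.elim_inl, Sum.elim_inr,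
      Sum.inl.injEq, Sum.inr.injEq, reduceCtorEq, if_false]
    rw [hswap, ← e1]
    simp only [spreadRate]
    ring
  rw [hset, hprod, hsum, Fintype.card_sum, Fintype.card_fin] at key
  exact key

open Classical in
/-- The case of several shifts and summable `ψ`. -/
theorem ae_tendsto_of_psiSummable (hT : MeasurePreserving (leftShift (A := A)) P P)
    (hℓ : 1 < ℓ) (hq : GrowthAssumption q)
    (hlr : ∀ n, l n ≤ r n) (hC : ∀ n i, IsCylinderOn (l n) (r n) (C n i))
    (hE : Tendsto (probSum P C) atTop atTop) (hP : PsiSummable P) {D : ℕ}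
    (hnest : ∀ m n, m < n → l n ≤ l m + D ∧ r m ≤ r n + D) :
    ∀ᵐ ω ∂P, Tendsto (fun N => hitSum q C N ω / probSum P C N) atTop (𝓝 1) := by
  by_cases hx : ∃ x : A, P.real {ω | ω 0 = x} = 1
  · exact hx.elim fun x hx => ae_tendsto_of_letter hT hE hx
  push Not at hx
  obtain ⟨K, -, hdiff, hfib, hpairs⟩ := hq
  obtain ⟨a, ha0, haa, has, hψ⟩ := hP.exists_psiMixing
  have hφ := hψ.phiMixing ha0
  obtain ⟨f, hf0, hf1, hfs, hf⟩ :=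
    hφ.exists_cylinder_bound has.tendsto_atTop_zero hT hx
  set F := tailRate a f D with hF
  have hF0 : ∀ k, 0 ≤ F k := tailRate_nonneg ha0 hf0 D
  have hFs : Summable F := summable_tailRate ha0 hf0 has hfs D
  have hUm := measurableSet_hitEvent (q := q) hC
  set G := separatedTimes q l r with hG
  set p : ℕ → ℝ := fun n => ∏ i, P.real (C n i) with hp
  have hp0 : ∀ n, 0 ≤ p n := fun n => Finset.prod_nonneg fun _ _ => measureReal_nonneg
  have hp1 : ∀ n, p n ≤ 1 := fun n =>
    Finset.prod_le_one (fun _ _ => measureReal_nonneg) fun _ _ => measureReal_le_one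
  -- At such a time the window length is at least half some distance |q_i(n) - q_j(n)|, so a single
  -- cylinder is already that unlikely.
  have hbad : ∀ n, n ∉ G → p n ≤ spreadRate f q n ∧
      P.real (hitEvent q C n) ≤ spreadRate f q n := by
    intro n hn
    simp only [hG, separatedTimes, Set.mem_ofPred_eq, not_forall, not_lt] at hn
    obtain ⟨i, j, hij, hle⟩ := hn
    have h1 : P.real (C n i) ≤ spreadRate f q n :=
      (hf _ _ _ (hC n i) _ (by omega)).trans (le_spreadRate hf0 q n hij)
    constructor
    · refine le_trans ?_ h1
      simp only [hp]
      rw [← Finset.mul_prod_erase _ _ (Finset.mem_univ i)]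
      exact mul_le_of_le_one_right measureReal_nonneg
        (Finset.prod_le_one (fun _ _ => measureReal_nonneg) fun _ _ => measureReal_le_one)
    · refine le_trans ?_ h1
      rw [← (hC n i).measureReal_preimage hT (q i n)]
      exact measureReal_mono (Set.iInter_subset _ i)
  have hsp : Summable (spreadRate f q) := summable_spread hf0 hfs hdiff
  have hspa : Summable (spreadRate a q) := summable_spread ha0 has hdiff
  simp only [hitSum_eq_occSum]
  refine ae_tendsto_occSum_div_of_restrict hUm hp0 hE G ?_ ?_ fun hE' => ?_
  · refine Summable.of_nonneg_of_le (fun n => ?_) (fun n => ?_) hsp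
    · split_ifs
      exacts [le_rfl, hp0 n]
    · split_ifs with h
      exacts [spreadRate_nonneg hf0 q n, (hbad n h).1]
  · refine Summable.of_nonneg_of_le (fun n => ?_) (fun n => ?_) hsp
    · split_ifs
      exacts [le_rfl, measureReal_nonneg]
    · split_ifs with h
      exacts [spreadRate_nonneg hf0 q n, (hbad n h).2]
  have hb := fun n (hn : n ∈ G) => hψ.hitEvent_bounds hT hℓ ha0 haa hlr hC hn
  set U' : ℕ → Set (ℤ → A) := fun n => if n ∈ G then hitEvent q C n else ∅ with hU'
  set p' : ℕ → ℝ := fun n => if n ∈ G then p n else 0 with hp'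
  have hU'm : ∀ n, MeasurableSet (U' n) := fun n => by
    simp only [hU']
    split_ifs
    exacts [hUm n, MeasurableSet.empty]
  have hp'0 : ∀ n, 0 ≤ p' n := fun n => by
    simp only [hp']
    split_ifs
    exacts [hp0 n, le_rfl]
  have hp'1 : ∀ n, p' n ≤ 1 := fun n => by
    simp only [hp']
    split_ifs
    exacts [hp1 n, zero_le_one]
  have ha00 := ha0 0
  set c₁ : ℝ := (1 + a 0) ^ ℓ with hc₁
  have hc₁1 : 1 ≤ c₁ := one_le_pow₀ (by linarith)
  set M : ℝ := (ℓ + ℓ : ℕ) * (1 + a 0) ^ (ℓ + ℓ) with hM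
  have hMℓ : (ℓ : ℝ) ≤ M := by
    have h1 : (1 : ℝ) ≤ (1 + a 0) ^ (ℓ + ℓ) := one_le_pow₀ (by linarith)
    have h2 : (ℓ : ℝ) ≤ (ℓ + ℓ : ℕ) := by push_cast; linarith [(Nat.cast_nonneg ℓ : (0 : ℝ) ≤ ℓ)]
    exact h2.trans (le_mul_of_one_le_right (by positivity) h1)
  have hM0 : 0 ≤ M := le_trans (Nat.cast_nonneg ℓ) hMℓ
  have hpair : ∀ m n, m < n → P.real (U' m ∩ U' n) ≤
      p' m * p' n * (1 + M * spreadRate a q m + M * spreadRate a q n) +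
        p' m * ((c₁ + 2 * M) * (crossRate F q m n + excess q m n)) := by
    intro m n hmn
    have hcr := crossRate_nonneg hF0 q m n
    have hex := excess_nonneg q m n
    have hsm := spreadRate_nonneg ha0 q m
    have hsn := spreadRate_nonneg ha0 q n
    have hnonneg : 0 ≤ p' m * p' n * (1 + M * spreadRate a q m + M * spreadRate a q n) :=
      mul_nonneg (mul_nonneg (hp'0 m) (hp'0 n)) (by positivity)
    by_cases hm : m ∈ G
    swap
    · have h1 : U' m = ∅ := if_neg hm
      rw [h1, Set.empty_inter, measureReal_empty]
      exact add_nonneg hnonneg (mul_nonneg (hp'0 m) (by positivity))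
    by_cases hn : n ∈ G
    swap
    · have h1 : U' n = ∅ := if_neg hn
      rw [h1, Set.inter_empty, measureReal_empty]
      exact add_nonneg hnonneg (mul_nonneg (hp'0 m) (by positivity))
    have e1 : U' m = hitEvent q C m := if_pos hm
    have e2 : U' n = hitEvent q C n := if_pos hn
    have e3 : p' m = p m := if_pos hm
    have e4 : p' n = p n := if_pos hn
    rw [e3, e4] at hnonneg
    rw [e1, e2, e3, e4]
    obtain ⟨hl, hr⟩ := hnest m n hmn
    have hbm := (hb m hm).1
    have hpm := hp0 m
    -- Common to the non-growing and the close pairs: P(U_m) ≤ c₁ p_m turns a bound relative to U_m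
    -- into an additive error with weight p_m.
    have hweak : ∀ x, 0 ≤ x → x ≤ crossRate F q m n + excess q m n →
        P.real (hitEvent q C m ∩ hitEvent q C n) ≤ P.real (hitEvent q C m) * x →
        P.real (hitEvent q C m ∩ hitEvent q C n) ≤
          p m * p n * (1 + M * spreadRate a q m + M * spreadRate a q n) +
          p m * ((c₁ + 2 * M) * (crossRate F q m n + excess q m n)) := by
      intro x hx0 hx hle
      refine le_add_of_nonneg_of_le hnonneg ?_
      calc _ ≤ P.real (hitEvent q C m) * x := hle
        _ ≤ (c₁ * p m) * (crossRate F q m n + excess q m n) := by gcongr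
        _ = p m * (c₁ * (crossRate F q m n + excess q m n)) := by ring
        _ ≤ _ := by gcongr; linarith
    by_cases htop : topShift q n ≤ topShift q m
    · have h1 : excess q m n = 1 := if_pos ⟨hmn, htop⟩
      refine hweak 1 zero_le_one (by linarith) ?_
      rw [mul_one]
      exact measureReal_mono Set.inter_subset_left
    push Not at htop
    by_cases hclose : ∃ i j : Fin ℓ,
        ((((q i n : ℤ) - q j m).natAbs / 2 : ℕ) : ℤ) ≤ r n - l n + D
    · obtain ⟨i, j, hij⟩ := hclose
      exact hweak _ hcr (by linarith)
        (hφ.hitEvent_inter_le_of_close ha0 hf0 hf1 hf hC hlr hr htop i j hij)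
    · push Not at hclose
      have h1 := hψ.hitEvent_inter_le_of_far hT hℓ ha0 haa hlr hC hm hn hl hr hclose
      have h2 : crossRate (fun k => a (k / 2)) q m n ≤ crossRate F q m n :=
        Finset.sum_le_sum fun i _ => Finset.sum_le_sum fun j _ =>
          le_add_of_nonneg_right (hf0 _)
      refine h1.trans ?_
      change p m * p n * (1 + M * _) ≤ _
      -- Of the far error, the spread part stays a factor on p_m p_n; the cross part is summable in
      -- n, so p_n ≤ 1 can be dropped and it joins θ.
      have h3 : p m * p n * (2 * M * crossRate (fun k => a (k / 2)) q m n) ≤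
          p m * ((c₁ + 2 * M) * (crossRate F q m n + excess q m n)) := by
        have h4 : 0 ≤ crossRate (fun k => a (k / 2)) q m n := crossRate_nonneg (fun k => ha0 _) q m n
        calc _ ≤ p m * 1 * (2 * M * crossRate (fun k => a (k / 2)) q m n) := by
              gcongr
              exact hp1 n
          _ = p m * (2 * M * crossRate (fun k => a (k / 2)) q m n) := by ring
          _ ≤ _ := by
              gcongr
              · linarith
              · linarith
      linarith
  set c : ℝ := ℓ * (ℓ * ((2 * K : ℕ) * ∑' k, F k)) + K with hc
  have hc0 : 0 ≤ c := by
    have : 0 ≤ ∑' k, F k := tsum_nonneg hF0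
    positivity
  set t : ℝ := ∑' n, spreadRate a q n with ht
  have ht0 : 0 ≤ t := tsum_nonneg (spreadRate_nonneg ha0 q)
  have hvar := integral_occSum_sub_sq_le (P := P) hU'm (p := p')
    (η := fun n => M * spreadRate a q n)
    (θ := fun m n => (c₁ + 2 * M) * (crossRate F q m n + excess q m n))
    (C := c₁ + M * t + (c₁ + 2 * M) * c) hp'0 hp'1
    (fun n => mul_nonneg hM0 (spreadRate_nonneg ha0 q n))
    (fun m n => mul_nonneg (by positivity)
      (add_nonneg (crossRate_nonneg hF0 q m n) (excess_nonneg q m n)))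
    (fun n => by
      simp only [hU', hp']
      split_ifs with h
      · refine (hb n h).1.trans ?_
        refine mul_le_mul_of_nonneg_right ?_ (hp0 n)
        have : 0 ≤ M * t + (c₁ + 2 * M) * c := by positivity
        linarith
      · simp)
    (fun n => by
      simp only [hU', hp']
      split_ifs with h
      · refine le_trans ?_ (hb n h).2
        refine mul_le_mul_of_nonneg_left ?_ (hp0 n)
        have := mul_le_mul_of_nonneg_right hMℓ (spreadRate_nonneg ha0 q n)
        linarith
      · simp)
    hpair
    (fun N => by
      rw [← Finset.mul_sum]
      have h1 := mul_le_mul_of_nonneg_left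
        (hspa.sum_le_tsum (Finset.Icc 1 N) fun n _ => spreadRate_nonneg ha0 q n) hM0
      have h2 : 0 ≤ (c₁ + 2 * M) * c := by positivity
      linarith)
    (fun m N => by
      rw [← Finset.mul_sum, Finset.sum_add_distrib]
      have h1 := sum_crossRate_le hF0 hFs hfib m (Finset.Icc 1 N)
      have h2 := sum_excess_le hpairs m (Finset.Icc 1 N)
      have h3 : (c₁ + 2 * M) * (∑ n ∈ Finset.Icc 1 N, crossRate F q m n +
          ∑ n ∈ Finset.Icc 1 N, excess q m n) ≤ (c₁ + 2 * M) * c := by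
        gcongr
        exact add_le_add h1 h2
      have h4 : 0 ≤ M * t := by positivity
      linarith)
  exact ae_tendsto_occSum_div hU'm hp'0 hp'1 hE' hvar

end Shift

end ShiftBC

theorem theorem2p3 {A : Type*} [Countable A] [MeasurableSpace A] [MeasurableSingletonClass A]
    (P : Measure (ℤ → A)) [IsProbabilityMeasure P]
    (hT : MeasurePreserving (ShiftBC.leftShift (A := A)) P P)
    (ℓ : ℕ) (q : Fin ℓ → ℕ → ℕ) (hq : ShiftBC.GrowthAssumption q)
    (l r : ℕ → ℤ) (hlr : ∀ n, 1 ≤ n → l n ≤ r n)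
    (C : ℕ → Fin ℓ → Set (ℤ → A))
    (hC : ∀ n, 1 ≤ n → ∀ i, ShiftBC.IsCylinderOn (l n) (r n) (C n i))
    (D : ℝ) (hD : 0 < D)
    (hE : Tendsto (ShiftBC.probSum P C) atTop atTop) :
    (ℓ = 1 → ShiftBC.PhiSummable P →
      (∀ m n, 1 ≤ m → m < n → ShiftBC.RightNested D (r m) (r n)) →
      ∀ᵐ ω ∂P, Tendsto (fun N => ShiftBC.hitSum q C N ω / ShiftBC.probSum P C N) atTop (𝓝 1)) ∧
    (1 < ℓ → ShiftBC.PsiSummable P →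
      (∀ m n, 1 ≤ m → m < n → ShiftBC.Nested D (l m) (r m) (l n) (r n)) →
      ∀ᵐ ω ∂P, Tendsto (fun N => ShiftBC.hitSum q C N ω / ShiftBC.probSum P C N) atTop (𝓝 1)) := by
  -- The unconstrained data at time 0 are replaced by those at time 1, so the hypotheses hold at all
  -- times; for the pair (0, 1) nestedness is then trivial.
  rw [← ShiftBC.probSum_max_one, ← ShiftBC.hitSum_max_one]
  rw [← ShiftBC.probSum_max_one] at hE
  have hlr' : ∀ n, l (max n 1) ≤ r (max n 1) := fun n => hlr _ (le_max_right n 1)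
  have hC' : ∀ n i, ShiftBC.IsCylinderOn (l (max n 1)) (r (max n 1)) (C (max n 1) i) :=
    fun n => hC _ (le_max_right n 1)
  have hle : ∀ x y : ℤ, (x : ℝ) < y + D → x ≤ y + (⌈D⌉₊ : ℕ) := fun x y h => by
    have h1 : (x : ℝ) ≤ y + (⌈D⌉₊ : ℕ) := h.le.trans (by gcongr; exact Nat.le_ceil D)
    exact_mod_cast h1
  constructor
  · rintro rfl hP hnest
    refine ShiftBC.ae_tendsto_of_phiSummable hT hq hlr' hC' hE hP (D := ⌈D⌉₊) fun m n hmn => ?_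
    rcases eq_or_ne (max m 1) (max n 1) with h | h
    · rw [h]; omega
    · exact hle _ _ (hnest _ _ (le_max_right m 1) (by omega))
  · intro hℓ hP hnest
    refine ShiftBC.ae_tendsto_of_psiSummable hT hℓ hq hlr' hC' hE hP (D := ⌈D⌉₊)
      fun m n hmn => ?_
    rcases eq_or_ne (max m 1) (max n 1) with h | h
    · rw [h]; omega
    · obtain ⟨h1, h2⟩ := hnest _ _ (le_max_right m 1) (by omega : max m 1 < max n 1)
      exact ⟨hle _ _ (by linarith), hle _ _ h2⟩
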